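/- **Setting.** Let $N\ge 2$, let $\Omega\subset\mathbb R^N$ be open and bounded, and let $X=(X_1,\dots,X_m)$ be locally Lipschitz vector fields on $\mathbb R^N$; for $u\in C^1$ write $Xu=(X_1u,\dots,X_mu)$. A path $\gamma:[0,T]\to\mathbb R^N$ is $X$-subunit if it is absolutely continuous and $\dot\gamma=\sum_j\theta_jX_j(\gamma)$ a.e. with measurable $\theta_j$, $\sum_j\theta_j^2\le 1$; $d_X(x,y)$ is the infimum of the $T>0$ for which some $X$-subunit path $\gamma:[0,T]\to\mathbb R^N$ has $\gamma(0)=x$, $\gamma(T)=y$. Let $U\supseteq\Omega$ be an open subset of $\mathbb R^N$ (both $U=\Omega$ and $U=\mathbb R^N$ are allowed), and write $B_r(x)=\{y\in U: d_X(x,y)<r\}$. Assume, for constants $Q>2$, $C_P>0$, $\nu>0$: * $d_X$ is finite on $U\times U$, and $d_X(x,y)\to0$ as $|y-x|\to0$, uniformly for $x,y$ in bounded subsets of $U$; * $0<|B_{2r}(x)|\le 2^Q|B_r(x)|$ for all $x\in\Omega$, $r>0$; * $\displaystyle\frac1{|B_r(x)|}\int_{B_r(x)}|u-u_r|\,dy\le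 \frac{C_P\,r}{|B_{\nu r}(x)|}\int_{B_{\nu r}(x)}|Xu|\,dy$ for all $x\in\Omega$, $r>0$ and all compactly supported $u\in C^1(\mathbb R^N)$, where $u_r=\frac1{|B_r(x)|}\int_{B_r(x)}u\,dy$. Let $W^{1,2}_0(\Omega,X)$ be the completion of $C_c^\infty(\Omega)$ for the norm $\|Xu\|_{L^2(\Omega)}$, realised as a space of functions: $u\in W_0^{1,2}(\Omega,X)$, with $X$-gradient $Xu$, if $u\in L^1(\Omega)$, $Xu\in L^2(\Omega;\mathbb R^m)$ and there are $\varphi_n\in C_c^\infty(\Omega)$ with $\varphi_n\to u$ in $L^1(\Omega)$ and $X\varphi_n\to Xu$ in $L^2(\Omega)$. Let $0<\alpha<\beta$ and let $A$ be a measurable $m\times m$ matrix-valued function on $\Omega$ with $\alpha|\eta|^2\le A(x)\eta\cdot\eta\le\beta|\eta|^2$ for a.e. $x\in\Omega$ and all $\eta\in\mathbb R^m$. For $p\ge1$, the Marcinkiewicz space $M^p(\Omega)$ consists of the measurable functions $u$ on $\Omega$ (scalar or vector valued) for which there is a finite $K\ge 0$ with $|\{x\in\Omega:|u(x)|\ge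 t\}|\le K/t^p$ for all $t>0$, and $\|u\|_{M^p}=K_*^{1/p}$ with $K_*$ the least such $K$. **Theorem 3.1.** There is a constant $C$, depending only on $\Omega$, $U$, $X$, $Q$, $C_P$, $\nu$ and $\alpha$, such that the following holds. Let $f\in L^1(\Omega)$ and, for $n\in\mathbb N$, let $f_n=T_n(f)$, where $T_n(s)=\max(-n,\min(s,n))$, and let $u_n\in W^{1,2}_0(\Omega,X)$ be a weak solution of $X^*(A\,Xu_n)=f_n$ in $\Omega$, $u_n=0$ on $\partial\Omega$, that is, $$\int_\Omega A\,Xu_n\cdot Xv=\int_\Omega f_n v\qquad\text{for all } v\in W_0^{1,2}(\Omega,X),$$ where both integrands are integrable. Then, for all $n$, $u_n\in M^{\frac{Q}{Q-2}}(\Omega)$, $Xu_n\in M^{\frac{Q}{Q-1}}(\Omega)$ and $$\|u_n\|_{M^{\frac{Q}{Q-2}}(\Omega)}\le C\|f\|_{L^1(\Omega)},\qquad \|Xu_n\|_{M^{\frac{Q}{Q-1}}(\Omega)}\le C\|f\|_{L^1(\Omega)}.$$ In particular both sequences are bounded in the respective spaces. -/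

import Mathlib

open MeasureTheory Filter Topology
open scoped ENNReal NNReal Matrix

noncomputable section

/-- The Euclidean space `ℝⁿ`. -/
abbrev EucSp (n : ℕ) : Type := EuclideanSpace ℝ (Fin n)

/-- The `X`-gradient `(X₁ u, …, Xₘ u)` of a (classically differentiable) function `u`, for the
vector fields `X₁, …, Xₘ` on `ℝᴺ`: its `j`-th component at `x` is the derivative of `u` at `x` in
the direction `X j x`. -/
def xGrad {N m : ℕ} (X : Fin m → EucSp N → EucSp N) (u : EucSp N → ℝ) (x : EucSp N) : EucSp m :=
  WithLp.toLp 2 (fun j => fderiv ℝ u x (X j x))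

/-- `γ : [0, T] → ℝᴺ` is an `X`-subunit path: it is absolutely continuous and
`γ' = ∑ j, θ j • X j (γ)` almost everywhere on `[0, T]`, with measurable `θ`, `∑ j, θ j ^ 2 ≤ 1`. -/
def IsSubunitPath {N m : ℕ} (X : Fin m → EucSp N → EucSp N) (T : ℝ) (γ : ℝ → EucSp N) : Prop :=
  AbsolutelyContinuousOnInterval γ 0 T ∧
    ∃ θ : ℝ → Fin m → ℝ, Measurable θ ∧
      ∀ᵐ t ∂(volume.restrict (Set.Icc 0 T)),
        ∑ j, θ t j ^ 2 ≤ 1 ∧ HasDerivAt γ (∑ j, θ t j • X j (γ t)) t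

/-- The control (Carnot–Carathéodory) distance of the family `X`: the infimum of the times `T > 0`
for which there is an `X`-subunit path in `ℝᴺ` from `x` to `y`
(`∞` if there is no such path). -/
def ccDist {N m : ℕ} (X : Fin m → EucSp N → EucSp N) (x y : EucSp N) : ℝ≥0∞ :=
  sInf {d : ℝ≥0∞ | ∃ T : ℝ, 0 < T ∧ d = ENNReal.ofReal T ∧
    ∃ γ : ℝ → EucSp N, IsSubunitPath X T γ ∧ γ 0 = x ∧ γ T = y}

/-- The ball of centre `x` and radius `r` in the space `(U, d_X)`. -/
def ccBall {N m : ℕ} (X : Fin m → EucSp N → EucSp N) (U : Set (EucSp N)) (x : EucSp N) (r : ℝ) :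
    Set (EucSp N) :=
  {y | y ∈ U ∧ ccDist X x y < ENNReal.ofReal r}

/-- The standing assumptions on the vector fields `X` and on the open set `Ω`. The control
distance is considered on an open set `U ⊇ Ω`, and the balls are those of `(U, d_X)`; the choices
`U = Ω` and `U = ℝᴺ` are both allowed. Doubling and Poincaré are only
required for balls centred in `Ω`.

The Poincaré inequality is for `u ∈ C¹` on the closure of the ball `B_{νr}`. A function that is
`C¹` near a compact set agrees near that set with a compactly supported `C¹` function on `ℝᴺ`, so
compactly supported `u` are used; all integrals are then finite. -/
structure XGeometry {N m : ℕ} (X : Fin m → EucSp N → EucSp N) (Ω U : Set (EucSp N))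
    (Q CP ν : ℝ) : Prop where
  /-- the vector fields are locally Lipschitz continuous -/
  lipschitz : ∀ j, LocallyLipschitz (X j)
  /-- any two points of `U` are at finite control distance -/
  connected : ∀ x ∈ U, ∀ y ∈ U, ccDist X x y < ⊤
  /-- `|y - x| → 0` implies `d_X (x, y) → 0`, uniformly on bounded subsets of `U` -/
  topology : ∀ R : ℝ, ∀ ε : ℝ, 0 < ε → ∃ δ : ℝ, 0 < δ ∧ ∀ x ∈ U, ∀ y ∈ U,
    ‖x‖ ≤ R → ‖y‖ ≤ R → ‖y - x‖ < δ → ccDist X x y < ENNReal.ofReal ε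
  /-- the doubling condition, with exponent `Q` -/
  doubling : ∀ x ∈ Ω, ∀ r : ℝ, 0 < r →
    0 < volume (ccBall X U x (2 * r)) ∧
      volume (ccBall X U x (2 * r)) ≤ ENNReal.ofReal ((2 : ℝ) ^ Q) * volume (ccBall X U x r)
  /-- the Poincaré inequality -/
  poincare : ∀ x ∈ Ω, ∀ r : ℝ, 0 < r → ∀ u : EucSp N → ℝ, ContDiff ℝ 1 u → HasCompactSupport u →
    (⨍ y in ccBall X U x r, |u y - ⨍ z in ccBall X U x r, u z|)
      ≤ CP * r * ⨍ y in ccBall X U x (ν * r), ‖xGrad X u y‖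

/-- `u ∈ W₀^{1,p}(Ω, X)` with `X`-gradient `g`. The space is the completion of `C_c^∞(Ω)` for the
norm `‖X u‖_{L^p(Ω)}`, realised as a space of functions: `u` is the limit in `L¹(Ω)` of functions
`φ n ∈ C_c^∞(Ω)` whose `X`-gradients converge to `g` in `L^p(Ω)`. -/
def HasXGradientW0 {N m : ℕ} (X : Fin m → EucSp N → EucSp N) (Ω : Set (EucSp N)) (p : ℝ≥0∞)
    (u : EucSp N → ℝ) (g : EucSp N → EucSp m) : Prop :=
  MemLp u 1 (volume.restrict Ω) ∧ MemLp g p (volume.restrict Ω) ∧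
    ∃ φ : ℕ → EucSp N → ℝ,
      (∀ n, ContDiff ℝ (⊤ : ℕ∞) (φ n) ∧ HasCompactSupport (φ n) ∧ tsupport (φ n) ⊆ Ω) ∧
      Tendsto (fun n => eLpNorm (fun x => φ n x - u x) 1 (volume.restrict Ω)) atTop (𝓝 0) ∧
      Tendsto (fun n => eLpNorm (fun x => xGrad X (φ n) x - g x) p (volume.restrict Ω))
        atTop (𝓝 0)

/-- `A` is a measurable matrix-valued function on `Ω` with
`α |η|² ≤ A(x) η · η ≤ β |η|²` for almost every `x ∈ Ω` and every `η ∈ ℝᵐ`. -/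
structure IsEllipticOn {N m : ℕ} (A : EucSp N → Matrix (Fin m) (Fin m) ℝ) (Ω : Set (EucSp N))
    (α β : ℝ) : Prop where
  measurable : ∀ i j, AEMeasurable (fun x => A x i j) (volume.restrict Ω)
  bounds : ∀ᵐ x ∂(volume.restrict Ω), ∀ η : EucSp m,
    α * ‖η‖ ^ 2 ≤ (A x *ᵥ η.ofLp) ⬝ᵥ η.ofLp ∧ (A x *ᵥ η.ofLp) ⬝ᵥ η.ofLp ≤ β * ‖η‖ ^ 2

/-- `u`, with `X`-gradient `g`, is a weak solution of `X^*(A(x) X u) = f` in `Ω`, `u = 0` on `∂Ω`: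
`u ∈ W₀^{1,2}(Ω, X)` and `∫_Ω A(x) X u · X v = ∫_Ω f v` for all `v ∈ W₀^{1,2}(Ω, X)`. -/
def IsWeakSolution {N m : ℕ} (X : Fin m → EucSp N → EucSp N) (Ω : Set (EucSp N))
    (A : EucSp N → Matrix (Fin m) (Fin m) ℝ) (f : EucSp N → ℝ)
    (u : EucSp N → ℝ) (g : EucSp N → EucSp m) : Prop :=
  HasXGradientW0 X Ω 2 u g ∧
    ∀ (v : EucSp N → ℝ) (h : EucSp N → EucSp m), HasXGradientW0 X Ω 2 v h →
      IntegrableOn (fun x => (A x *ᵥ (g x).ofLp) ⬝ᵥ (h x).ofLp) Ω ∧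
      IntegrableOn (fun x => f x * v x) Ω ∧
      ∫ x in Ω, (A x *ᵥ (g x).ofLp) ⬝ᵥ (h x).ofLp = ∫ x in Ω, f x * v x

/-- The truncation at height `k`. -/
def truncAt (k s : ℝ) : ℝ := if k < s then k else if s < -k then -k else s

/-- The admissible constants `K` in `|{|u| ≥ t}| ≤ K / t ^ p` for all `t > 0`. -/
def marcinkiewiczConstants {N : ℕ} {F : Type*} [NormedAddCommGroup F] (Ω : Set (EucSp N)) (p : ℝ)
    (u : EucSp N → F) : Set ℝ≥0∞ :=
  {K | ∀ t : ℝ, 0 < t → volume.restrict Ω {x | t ≤ ‖u x‖} ≤ K / ENNReal.ofReal (t ^ p)}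

/-- Membership in the Marcinkiewicz space `M^p(Ω)` (also for vector-valued functions). -/
def MemMarcinkiewicz {N : ℕ} {F : Type*} [NormedAddCommGroup F] (Ω : Set (EucSp N)) (p : ℝ)
    (u : EucSp N → F) : Prop :=
  AEStronglyMeasurable u (volume.restrict Ω) ∧ ∃ K ∈ marcinkiewiczConstants Ω p u, K < ⊤

/-- The norm of `M^p(Ω)`: the optimal constant to the power `1 / p`. -/
def marcinkiewiczNorm {N : ℕ} {F : Type*} [NormedAddCommGroup F] (Ω : Set (EucSp N)) (p : ℝ)
    (u : EucSp N → F) : ℝ≥0∞ :=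
  (sInf (marcinkiewiczConstants Ω p u)) ^ (1 / p)

end

/-! ### Absolutely continuous curves and subunit paths -/

/-! The equation is tested with `S(u)`, where `S(s) = k arctan(s/k)` is a smooth substitute for
truncation at height `k`. Since `|S| ≤ 2k`, ellipticity gives `∫ S'(u)|Xu|² ≤ 2k‖f‖₁/α`
(`IsWeakSolution.integral_deriv_softTrunc_mul_le`). A weak Sobolev inequality, `|{|v| ≥ l}| ≤ C
(G/l²)^(Q/(Q-2))` when `∫|Xv|² < G`, applied to `v = S(u)` with `G ~ k‖f‖₁` and `l ~ k`, gives the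
decay of `u`. For the gradient, `{|Xu| ≥ t}` is split into `{|u| ≥ k}` and a part handled by
Chebyshev's inequality, and `k` is chosen to balance the two (`XGeometry.exists_volume_level_le`).

The Sobolev inequality is proved for test functions and passed to the limit. Averages over dyadic
control balls telescope, and Poincaré bounds each increment by an average of `|Xφ|`
(`XGeometry.abs_sub_average_le`). At large scales that average is bounded by the total energy and
the lower volume bound from doubling, at small scales by a maximal function, whose exceptional set
is small by a Vitali covering (`XGeometry.mul_volume_le_of_forall_exists`).

What remains is the average over one ball containing `Ω`, that is, a Friedrichs inequality `∫|φ| ≤ C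
∫|Xφ|` (`XGeometry.exists_integral_abs_le`). Since `U = Ω` is allowed, a ball need not contain any
region outside `Ω` where `φ` vanishes, and Poincaré alone cannot exclude constants. If the
inequality failed, normalised test functions would tend to `1` on `Ω` with `X`-gradients tending to
`0`, so the divergence theorem along `X` would hold on `Ωᶜ` without boundary term. Small Euclidean
balls transported along subunit paths would then stay in `Ω` up to null sets
(`IsSubunitPath.volume_ball_diff_eq_zero`). As `Ω` has finite control diameter, the balls keep a
uniform radius, so `closure Ω` would be open as well as closed and bounded, which is absurd
(`XGeometry.not_tendsto_one`). -/

theorem LipschitzWith.comp_absolutelyContinuousOnInterval {E F : Type*} [PseudoMetricSpace E]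
    [PseudoMetricSpace F] {f : E → F} {K : ℝ≥0} (hf : LipschitzWith K f) {γ : ℝ → E} {a b : ℝ}
    (hγ : AbsolutelyContinuousOnInterval γ a b) :
    AbsolutelyContinuousOnInterval (fun t => f (γ t)) a b := by
  rw [absolutelyContinuousOnInterval_iff] at hγ ⊢
  intro ε hε
  obtain ⟨δ, hδ, h⟩ := hγ (ε / (K + 1)) (by positivity)
  refine ⟨δ, hδ, fun E hE hl => ?_⟩
  have h1 := h E hE hl
  calc ∑ i ∈ Finset.range E.1, dist (f (γ (E.2 i).1)) (f (γ (E.2 i).2))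
      ≤ ∑ i ∈ Finset.range E.1, (K + 1) * dist (γ (E.2 i).1) (γ (E.2 i).2) := by
        refine Finset.sum_le_sum fun i _ => (hf.dist_le_mul _ _).trans ?_
        gcongr
        simp
    _ = (K + 1) * ∑ i ∈ Finset.range E.1, dist (γ (E.2 i).1) (γ (E.2 i).2) := by
        rw [Finset.mul_sum]
    _ < (K + 1) * (ε / (K + 1)) := by gcongr
    _ = ε := by field_simp

theorem AbsolutelyContinuousOnInterval.sub_le_of_ae_deriv_le {f : ℝ → ℝ} {a b C : ℝ} (hab : a ≤ b)
    (hf : AbsolutelyContinuousOnInterval f a b)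
    (h : ∀ᵐ t, t ∈ Set.Icc a b → deriv f t ≤ C) : f b - f a ≤ C * (b - a) := by
  rw [← hf.integral_deriv_eq_sub, mul_comm]
  have : ∫ t in a..b, C = (b - a) * C := by simp
  rw [← this]
  refine intervalIntegral.integral_mono_ae_restrict hab hf.intervalIntegrable_deriv (by simp) ?_
  exact (ae_restrict_iff' measurableSet_Icc).2 h

/-- Reduction to the scalar case: pair the curve with its own increment `v = γ b - γ a`, then divide
by `‖v‖`. -/
theorem AbsolutelyContinuousOnInterval.dist_le_of_ae_hasDerivAt {E : Type*} [NormedAddCommGroup E]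
    [InnerProductSpace ℝ E] {γ γ' : ℝ → E} {a b M : ℝ} (hab : a ≤ b)
    (hγ : AbsolutelyContinuousOnInterval γ a b)
    (h : ∀ᵐ t, t ∈ Set.Icc a b → HasDerivAt γ (γ' t) t ∧ ‖γ' t‖ ≤ M) :
    dist (γ a) (γ b) ≤ M * (b - a) := by
  set v := γ b - γ a with hv
  have hac : AbsolutelyContinuousOnInterval (fun t => inner ℝ v (γ t)) a b :=
    (innerSL ℝ v).lipschitz.comp_absolutelyContinuousOnInterval hγ
  have h1 := hac.sub_le_of_ae_deriv_le (C := ‖v‖ * M) hab (by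
    filter_upwards [h] with t ht hmem
    obtain ⟨h1, h2⟩ := ht hmem
    have h3 : HasDerivAt (fun t => inner ℝ v (γ t)) (inner ℝ v (γ' t)) t :=
      ((innerSL ℝ v).hasFDerivAt.comp_hasDerivAt t h1)
    rw [h3.deriv]
    exact (real_inner_le_norm _ _).trans (by gcongr))
  rw [← inner_sub_right, ← hv, real_inner_self_eq_norm_sq] at h1
  rw [dist_comm, dist_eq_norm, ← hv]
  by_cases h0 : ‖v‖ = 0
  · rw [h0]
    -- `M` is not assumed nonnegative; when `a < b`, its sign comes from a single time at which the
    -- speed bound holds.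
    have hM : b - a = 0 ∨ 0 ≤ M := by
      rcases hab.eq_or_lt with rfl | hlt
      · left; ring
      · right
        have : (volume.restrict (Set.Icc a b)) ≠ 0 := by simp [hlt]
        have h' := (ae_restrict_iff' measurableSet_Icc).2 h
        have : (ae (volume.restrict (Set.Icc a b))).NeBot := ae_neBot.2 this
        obtain ⟨t, ht⟩ := h'.exists
        exact (norm_nonneg _).trans ht.2
    rcases hM with hM | hM
    · simp [hM]
    · exact mul_nonneg hM (by linarith)
  · have h0' : 0 < ‖v‖ := lt_of_le_of_ne (norm_nonneg _) (Ne.symm h0)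
    have : ‖v‖ * ‖v‖ ≤ ‖v‖ * (M * (b - a)) := by nlinarith
    exact le_of_mul_le_mul_left this h0'

section Subunit

variable {N m : ℕ} {X : Fin m → EucSp N → EucSp N}

theorem norm_sum_smul_le {θ : Fin m → ℝ} {E : Type*} [NormedAddCommGroup E] [NormedSpace ℝ E]
    (hθ : ∑ j, θ j ^ 2 ≤ 1) (w : Fin m → E) :
    ‖∑ j, θ j • w j‖ ≤ ∑ j, ‖w j‖ := by
  refine (norm_sum_le _ _).trans (Finset.sum_le_sum fun j _ => ?_)
  rw [norm_smul]
  have h1 : θ j ^ 2 ≤ 1 :=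
    (Finset.single_le_sum (f := fun j => θ j ^ 2) (fun i _ => sq_nonneg _) (Finset.mem_univ j)).trans hθ
  have h2 : ‖θ j‖ ≤ 1 := by
    rw [Real.norm_eq_abs]; exact abs_le_one_iff_mul_self_le_one.2 (by nlinarith)
  nlinarith [norm_nonneg (w j)]

/-- The velocity of a subunit path at the point `x` is at most `speedBound X x`. -/
noncomputable def speedBound (X : Fin m → EucSp N → EucSp N) (x : EucSp N) : ℝ := ∑ j, ‖X j x‖

theorem continuous_speedBound (hX : ∀ j, Continuous (X j)) : Continuous (speedBound X) := by
  unfold speedBound; fun_prop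

theorem exists_speedBound_le (hX : ∀ j, Continuous (X j)) {K : Set (EucSp N)} (hK : IsCompact K) :
    ∃ M : ℝ, 0 < M ∧ ∀ x ∈ K, speedBound X x ≤ M := by
  obtain ⟨M, hM⟩ := hK.exists_bound_of_continuousOn (continuous_speedBound hX).continuousOn
  exact ⟨max M 1, by positivity, fun x hx =>
    (le_abs_self _).trans ((hM x hx).trans (le_max_left _ _))⟩

theorem IsSubunitPath.continuousOn {T : ℝ} {γ : ℝ → EucSp N} (hT : 0 ≤ T)
    (h : IsSubunitPath X T γ) : ContinuousOn γ (Set.Icc 0 T) := by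
  have := h.1.continuousOn
  rwa [Set.uIcc_of_le hT] at this

theorem IsSubunitPath.dist_le {T : ℝ} {γ : ℝ → EucSp N}
    (h : IsSubunitPath X T γ) {a b M : ℝ} (ha : 0 ≤ a) (hab : a ≤ b) (hb : b ≤ T)
    (hM : ∀ t ∈ Set.Icc a b, speedBound X (γ t) ≤ M) : dist (γ a) (γ b) ≤ M * (b - a) := by
  obtain ⟨hac, θ, -, hθ⟩ := h
  have hsub : Set.Icc a b ⊆ Set.Icc 0 T := Set.Icc_subset_Icc ha hb
  refine (hac.mono (by rwa [Set.uIcc_of_le hab, Set.uIcc_of_le (ha.trans (hab.trans hb))])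
    ).dist_le_of_ae_hasDerivAt hab (γ' := fun t => ∑ j, θ t j • X j (γ t)) ?_
  filter_upwards [(ae_restrict_iff' measurableSet_Icc).1 hθ] with t ht hmem
  obtain ⟨h1, h2⟩ := ht (hsub hmem)
  exact ⟨h2, (norm_sum_smul_le h1 _).trans (hM t hmem)⟩

/-- The speed is bounded on the compact image of the path. Lipschitz continuity is easier to carry
through reversal and concatenation than absolute continuity. -/
theorem IsSubunitPath.exists_lipschitzOnWith (hX : ∀ j, Continuous (X j)) {T : ℝ}
    {γ : ℝ → EucSp N} (hT : 0 ≤ T) (h : IsSubunitPath X T γ) :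
    ∃ K, LipschitzOnWith K γ (Set.Icc 0 T) := by
  obtain ⟨M, hM0, hM⟩ := exists_speedBound_le hX (isCompact_Icc.image_of_continuousOn
    (h.continuousOn hT))
  refine ⟨M.toNNReal, LipschitzOnWith.of_dist_le_mul fun s hs t ht => ?_⟩
  rw [Real.coe_toNNReal _ hM0.le]
  wlog hst : s ≤ t generalizing s t
  · rw [dist_comm, dist_comm s]; exact this t ht s hs (le_of_not_ge hst)
  rw [Real.dist_eq, abs_sub_comm, abs_of_nonneg (by linarith)]
  exact h.dist_le hs.1 hst ht.2 fun r hr =>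
    hM _ ⟨r, ⟨hs.1.trans hr.1, hr.2.trans ht.2⟩, rfl⟩

/-- A short subunit path stays close to its starting point. -/
theorem IsSubunitPath.dist_lt_of_mul_lt {T : ℝ} {γ : ℝ → EucSp N} (hT : 0 ≤ T)
    (h : IsSubunitPath X T γ) {ρ M : ℝ} (hM0 : 0 ≤ M)
    (hM : ∀ y ∈ Metric.closedBall (γ 0) ρ, speedBound X y ≤ M) (hTM : T * M < ρ) :
    ∀ t ∈ Set.Icc 0 T, dist (γ 0) (γ t) ≤ M * t := by
  have hcont : ContinuousOn (fun t => dist (γ 0) (γ t)) (Set.Icc 0 T) :=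
    (continuous_const.dist continuous_id).comp_continuousOn (h.continuousOn hT)
  have key : ∀ t ∈ Set.Icc 0 T, dist (γ 0) (γ t) < ρ := by
    by_contra! hcon
    obtain ⟨t1, ht1, hd1⟩ := hcon
    -- First exit time: up to the first time `t0` at distance `ρ` the speed is at most `M`, so the
    -- distance covered is at most `M * t0 ≤ M * T < ρ`.
    have hcl : IsCompact (Set.Icc 0 T ∩ (fun t => dist (γ 0) (γ t)) ⁻¹' Set.Ici ρ) := by
      refine isCompact_Icc.of_isClosed_subset ?_ Set.inter_subset_left
      exact ContinuousOn.preimage_isClosed_of_isClosed hcont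
        isClosed_Icc isClosed_Ici
    obtain ⟨t0, ⟨ht0, hd0⟩, hmin⟩ := hcl.exists_isLeast ⟨t1, ht1, hd1⟩
    have hlt : ∀ s ∈ Set.Ico 0 t0, dist (γ 0) (γ s) < ρ := fun s hs => by
      by_contra! hc
      exact absurd (hmin ⟨⟨hs.1, hs.2.le.trans ht0.2⟩, hc⟩) (not_le.2 hs.2)
    have hd0' : dist (γ 0) (γ t0) ≤ ρ := by
      rcases ht0.1.eq_or_lt with h0 | h0
      · rw [← h0, dist_self]; nlinarith
      · have h2 : ContinuousOn (fun s => dist (γ 0) (γ s)) (Set.Icc 0 t0) :=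
          hcont.mono (Set.Icc_subset_Icc_right ht0.2)
        have h4 : closure (Set.Ico 0 t0) = Set.Icc 0 t0 := closure_Ico h0.ne
        have h5 : Set.Icc 0 t0 ⊆ (fun s => dist (γ 0) (γ s)) ⁻¹' (Set.Iic ρ) := by
          have h6 := h2.preimage_isClosed_of_isClosed isClosed_Icc (isClosed_Iic (a := ρ))
          rw [← h4]
          refine (closure_minimal (fun s hs => ?_) h6).trans Set.inter_subset_right
          exact ⟨Set.Ico_subset_Icc_self hs, (hlt s hs).le⟩
        exact h5 ⟨h0.le, le_rfl⟩
    have h1 := h.dist_le le_rfl ht0.1 ht0.2 (M := M) fun s hs => hM _ (by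
      rw [Metric.mem_closedBall, dist_comm]
      rcases hs.2.eq_or_lt with rfl | h'
      · exact hd0'
      · exact (hlt s ⟨hs.1, h'⟩).le)
    have : ρ ≤ dist (γ 0) (γ t0) := hd0
    nlinarith [ht0.2]
  exact fun t ht => by
    simpa using h.dist_le le_rfl ht.1 ht.2 (M := M) fun s hs =>
      hM _ (by rw [Metric.mem_closedBall, dist_comm]; exact (key s ⟨hs.1, hs.2.trans ht.2⟩).le)

theorem isSubunitPath_const (x : EucSp N) (T : ℝ) : IsSubunitPath X T (fun _ => x) := by
  refine ⟨(LipschitzOnWith.absolutelyContinuousOnInterval (K := 0)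
    ((LipschitzWith.const x).lipschitzOnWith)), 0, measurable_const, ?_⟩
  exact Filter.Eventually.of_forall fun t => by simpa using hasDerivAt_const t x

theorem IsSubunitPath.reverse (hX : ∀ j, Continuous (X j)) {T : ℝ} (hT : 0 ≤ T)
    {γ : ℝ → EucSp N} (h : IsSubunitPath X T γ) : IsSubunitPath X T (fun t => γ (T - t)) := by
  obtain ⟨K, hK⟩ := h.exists_lipschitzOnWith hX hT
  obtain ⟨-, θ, hθm, hθ⟩ := h
  have hmaps : ∀ t ∈ Set.Icc 0 T, T - t ∈ Set.Icc 0 T := fun t ht =>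
    ⟨by linarith [ht.2], by linarith [ht.1]⟩
  refine ⟨LipschitzOnWith.absolutelyContinuousOnInterval (K := K) ?_, fun t => -θ (T - t),
    by fun_prop, ?_⟩
  · rw [Set.uIcc_of_le hT]
    refine LipschitzOnWith.of_dist_le_mul fun s hs t ht => ?_
    refine (hK.dist_le_mul _ (hmaps s hs) _ (hmaps t ht)).trans_eq ?_
    rw [Real.dist_eq, Real.dist_eq, ← abs_neg (s - t)]
    congr 2; ring
  · rw [ae_restrict_iff' measurableSet_Icc] at hθ ⊢
    have hq := (Measure.measurePreserving_sub_left volume T).quasiMeasurePreserving.ae hθ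
    filter_upwards [hq] with t ht hmem
    obtain ⟨h1, h2⟩ := ht (hmaps t hmem)
    refine ⟨by simpa using h1, ?_⟩
    have h3 : HasDerivAt (fun s : ℝ => T - s) (-1) t := by
      simpa using (hasDerivAt_id t).const_sub T
    have h4 := HasDerivAt.scomp t h2 h3
    simpa [Function.comp_def] using h4

/-- The sum of the two Lipschitz constants serves the joined path, and the joining time, where the
derivative may fail to exist, is a null set. -/
theorem IsSubunitPath.concat (hX : ∀ j, Continuous (X j)) {T₁ T₂ : ℝ} (hT₁ : 0 ≤ T₁)
    (hT₂ : 0 ≤ T₂) {γ₁ γ₂ : ℝ → EucSp N} (h₁ : IsSubunitPath X T₁ γ₁)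
    (h₂ : IsSubunitPath X T₂ γ₂) (hγ : γ₁ T₁ = γ₂ 0) :
    IsSubunitPath X (T₁ + T₂) (fun t => if t ≤ T₁ then γ₁ t else γ₂ (t - T₁)) := by
  obtain ⟨K₁, hK₁⟩ := h₁.exists_lipschitzOnWith hX hT₁
  obtain ⟨K₂, hK₂⟩ := h₂.exists_lipschitzOnWith hX hT₂
  obtain ⟨-, θ₁, hθm₁, hθ₁⟩ := h₁
  obtain ⟨-, θ₂, hθm₂, hθ₂⟩ := h₂
  refine ⟨LipschitzOnWith.absolutelyContinuousOnInterval (K := K₁ + K₂) ?_,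
    fun t => if t ≤ T₁ then θ₁ t else θ₂ (t - T₁),
    Measurable.ite measurableSet_Iic hθm₁ (by fun_prop), ?_⟩
  · rw [Set.uIcc_of_le (by linarith)]
    refine LipschitzOnWith.of_dist_le_mul fun s hs t ht => ?_
    wlog hst : s ≤ t generalizing s t
    · rw [dist_comm, dist_comm s]; exact this t ht s hs (le_of_not_ge hst)
    have e1 : ∀ a b : ℝ, a ≤ b → dist a b = b - a := fun a b hab => by
      rw [Real.dist_eq, abs_sub_comm, abs_of_nonneg (by linarith)]
    have l1 : ∀ a b : ℝ, 0 ≤ a → a ≤ b → b ≤ T₁ → dist (γ₁ a) (γ₁ b) ≤ K₁ * (b - a) :=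
      fun a b ha hab hb => by
        rw [← e1 a b hab]; exact hK₁.dist_le_mul _ ⟨ha, by linarith⟩ _ ⟨by linarith, hb⟩
    have l2 : ∀ a b : ℝ, 0 ≤ a → a ≤ b → b ≤ T₂ → dist (γ₂ a) (γ₂ b) ≤ K₂ * (b - a) :=
      fun a b ha hab hb => by
        rw [← e1 a b hab]; exact hK₂.dist_le_mul _ ⟨ha, by linarith⟩ _ ⟨by linarith, hb⟩
    rw [e1 _ _ hst]
    push_cast
    have hK1 := K₁.2
    have hK2 := K₂.2
    by_cases ht1 : t ≤ T₁
    · simp only [ht1, hst.trans ht1, if_true]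
      exact (l1 s t hs.1 hst ht1).trans (mul_le_mul_of_nonneg_right (by simp) (by linarith))
    · by_cases hs1 : s ≤ T₁
      · simp only [ht1, hs1, if_true, if_false]
        refine (dist_triangle _ (γ₁ T₁) _).trans ?_
        have a1 := l1 s T₁ hs.1 hs1 le_rfl
        have a2 := l2 0 (t - T₁) le_rfl (by linarith) (by linarith [ht.2])
        rw [← hγ] at a2
        have b1 : (K₁ : ℝ) * (T₁ - s) ≤ K₁ * (t - s) := mul_le_mul_of_nonneg_left (by linarith) hK1
        have b2 : (K₂ : ℝ) * (t - T₁ - 0) ≤ K₂ * (t - s) :=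
          mul_le_mul_of_nonneg_left (by linarith) hK2
        linarith
      · simp only [ht1, hs1, if_false]
        refine (l2 (s - T₁) (t - T₁) (by linarith) (by linarith) (by linarith [ht.2])).trans ?_
        rw [sub_sub_sub_cancel_right]
        exact mul_le_mul_of_nonneg_right (by simp) (by linarith)
  · rw [ae_restrict_iff' measurableSet_Icc] at hθ₁ hθ₂ ⊢
    have hq := (measurePreserving_sub_right volume T₁).quasiMeasurePreserving.ae hθ₂
    have hne : ∀ᵐ t : ℝ, t ≠ T₁ := by simp [ae_iff]
    filter_upwards [hθ₁, hq, hne] with t ht₁ ht₂ hneq hmem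
    rcases lt_or_gt_of_ne hneq with hlt | hgt
    · obtain ⟨a1, a2⟩ := ht₁ ⟨hmem.1, hlt.le⟩
      simp only [hlt.le, if_true]
      refine ⟨a1, a2.congr_of_eventuallyEq ?_⟩
      filter_upwards [Iio_mem_nhds hlt] with s hs
      simp [le_of_lt (show s < T₁ from hs)]
    · obtain ⟨a1, a2⟩ := ht₂ ⟨by linarith, by linarith [hmem.2]⟩
      simp only [not_le.2 hgt, if_false]
      refine ⟨a1, ?_⟩
      have a3 : HasDerivAt (fun s => γ₂ (s - T₁)) (∑ j, θ₂ (t - T₁) j • X j (γ₂ (t - T₁))) t := by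
        exact a2.comp_sub_const t T₁
      refine a3.congr_of_eventuallyEq ?_
      filter_upwards [Ioi_mem_nhds hgt] with s hs
      simp [not_le.2 (show T₁ < s from hs)]

/-! ### The control distance -/

/-- The infimum need not be attained, so the distance is handled through strict inequalities;
symmetry and the triangle inequality then reduce to reversing and joining paths. -/
theorem ccDist_lt_ofReal_iff {x y : EucSp N} {r : ℝ} :
    ccDist X x y < ENNReal.ofReal r ↔ ∃ T : ℝ, 0 < T ∧ T < r ∧
      ∃ γ : ℝ → EucSp N, IsSubunitPath X T γ ∧ γ 0 = x ∧ γ T = y := by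
  unfold ccDist
  rw [sInf_lt_iff]
  constructor
  · rintro ⟨_, ⟨T, hT, rfl, hγ⟩, hlt⟩
    exact ⟨T, hT, (ENNReal.ofReal_lt_ofReal_iff_of_nonneg hT.le).1 hlt, hγ⟩
  · rintro ⟨T, hT, hTr, hγ⟩
    exact ⟨_, ⟨T, hT, rfl, hγ⟩, (ENNReal.ofReal_lt_ofReal_iff_of_nonneg hT.le).2 hTr⟩

theorem ccDist_self_lt (x : EucSp N) {r : ℝ} (hr : 0 < r) : ccDist X x x < ENNReal.ofReal r :=
  ccDist_lt_ofReal_iff.2 ⟨r / 2, by linarith, by linarith, _, isSubunitPath_const x _, rfl, rfl⟩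

theorem ccDist_lt_symm (hX : ∀ j, Continuous (X j)) {x y : EucSp N} {r : ℝ}
    (h : ccDist X x y < ENNReal.ofReal r) : ccDist X y x < ENNReal.ofReal r := by
  obtain ⟨T, hT, hTr, γ, hγ, h0, h1⟩ := ccDist_lt_ofReal_iff.1 h
  exact ccDist_lt_ofReal_iff.2 ⟨T, hT, hTr, _, hγ.reverse hX hT.le, by simpa, by simpa⟩

theorem ccDist_lt_add (hX : ∀ j, Continuous (X j)) {x y z : EucSp N} {r s : ℝ}
    (h₁ : ccDist X x y < ENNReal.ofReal r) (h₂ : ccDist X y z < ENNReal.ofReal s) :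
    ccDist X x z < ENNReal.ofReal (r + s) := by
  obtain ⟨T, hT, hTr, γ, hγ, h0, h1⟩ := ccDist_lt_ofReal_iff.1 h₁
  obtain ⟨S, hS, hSs, η, hη, k0, k1⟩ := ccDist_lt_ofReal_iff.1 h₂
  refine ccDist_lt_ofReal_iff.2 ⟨T + S, by linarith, by linarith, _,
    hγ.concat hX hT.le hS.le hη (h1.trans k0.symm), ?_, ?_⟩
  · simp [hT.le, h0]
  · simp [hS, k1]

/-- A path of length `T < r` leaves slack `r - T`, half of which is spent on reaching a Euclidean
neighbour of `y`. -/
theorem isOpen_ccBall (hX : ∀ j, Continuous (X j)) {U : Set (EucSp N)} (hU : IsOpen U)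
    (htop : ∀ R : ℝ, ∀ ε : ℝ, 0 < ε → ∃ δ : ℝ, 0 < δ ∧ ∀ x ∈ U, ∀ y ∈ U,
      ‖x‖ ≤ R → ‖y‖ ≤ R → ‖y - x‖ < δ → ccDist X x y < ENNReal.ofReal ε)
    (x : EucSp N) (r : ℝ) : IsOpen (ccBall X U x r) := by
  rw [Metric.isOpen_iff]
  rintro y ⟨hyU, hy⟩
  obtain ⟨T, hT, hTr, γ, hγ, h0, h1⟩ := ccDist_lt_ofReal_iff.1 hy
  have hy' : ccDist X x y < ENNReal.ofReal ((T + r) / 2) :=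
    ccDist_lt_ofReal_iff.2 ⟨T, hT, by linarith, γ, hγ, h0, h1⟩
  obtain ⟨δ, hδ, hd⟩ := htop (‖y‖ + 1) ((r - T) / 2) (by linarith)
  obtain ⟨δ', hδ', hd'⟩ := Metric.isOpen_iff.1 hU y hyU
  refine ⟨min (min δ δ') 1, by positivity, fun z hz => ?_⟩
  rw [Metric.mem_ball, lt_min_iff, lt_min_iff, dist_eq_norm] at hz
  have hzU : z ∈ U := hd' (by rw [Metric.mem_ball, dist_eq_norm]; exact hz.1.2)
  refine ⟨hzU, ?_⟩
  have := ccDist_lt_add hX hy' (hd y hyU z hzU (by linarith) (by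
    have := norm_sub_norm_le z y
    linarith [hz.2]) hz.1.1)
  rwa [show (T + r) / 2 + (r - T) / 2 = r by ring] at this

/-- Control balls of small radius are contained in Euclidean balls. -/
theorem exists_ccDist_lt_imp_dist_le (hX : ∀ j, Continuous (X j)) {B : Set (EucSp N)}
    (hB : Bornology.IsBounded B) :
    ∃ M : ℝ, 0 < M ∧ ∀ x ∈ B, ∀ r : ℝ, r ≤ 1 / M → ∀ y, ccDist X x y < ENNReal.ofReal r →
      dist x y ≤ M * r := by
  obtain ⟨R, hR⟩ := hB.subset_closedBall 0
  obtain ⟨M, hM0, hM⟩ := exists_speedBound_le hX (isCompact_closedBall (0 : EucSp N) (R + 1))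
  refine ⟨M, hM0, fun x hx r hr y hy => ?_⟩
  obtain ⟨T, hT, hTr, γ, hγ, rfl, rfl⟩ := ccDist_lt_ofReal_iff.1 hy
  have h1 := hγ.dist_lt_of_mul_lt hT.le (ρ := 1) hM0.le (fun y hy => hM y ?_) ?_ T ⟨hT.le, le_rfl⟩
  · exact h1.trans (by gcongr)
  · have := hR hx
    simp only [Metric.mem_closedBall, dist_eq_norm, sub_zero] at this hy ⊢
    have := norm_sub_norm_le y (γ 0)
    linarith
  · calc T * M < 1 / M * M := by gcongr; linarith
      _ = 1 := by field_simp

end Subunit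

/-! ### Volumes of control balls -/

section Volumes

variable {N m : ℕ} {X : Fin m → EucSp N → EucSp N} {Ω U : Set (EucSp N)} {Q CP ν : ℝ}

theorem ccBall_mono (x : EucSp N) {r s : ℝ} (h : r ≤ s) : ccBall X U x r ⊆ ccBall X U x s :=
  fun _ hy => ⟨hy.1, hy.2.trans_le (ENNReal.ofReal_le_ofReal h)⟩

theorem mem_ccBall_self {x : EucSp N} (hx : x ∈ U) {r : ℝ} (hr : 0 < r) : x ∈ ccBall X U x r :=
  ⟨hx, ccDist_self_lt x hr⟩

namespace XGeometry

theorem continuous (hX : XGeometry X Ω U Q CP ν) (j : Fin m) : Continuous (X j) :=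
  (hX.lipschitz j).continuous

theorem isOpen_ccBall (hX : XGeometry X Ω U Q CP ν) (hU : IsOpen U) (x : EucSp N) (r : ℝ) :
    IsOpen (ccBall X U x r) :=
  _root_.isOpen_ccBall hX.continuous hU hX.topology x r

theorem volume_ccBall_pos (hX : XGeometry X Ω U Q CP ν) {x : EucSp N} (hx : x ∈ Ω) {r : ℝ}
    (hr : 0 < r) : 0 < volume (ccBall X U x r) := by
  have := (hX.doubling x hx (r / 2) (by linarith)).1
  rwa [mul_div_cancel₀ r (two_ne_zero)] at this

/-- A small control ball lies in a Euclidean ball, and doubling carries finiteness up to every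
radius. -/
theorem volume_ccBall_lt_top (hX : XGeometry X Ω U Q CP ν) {x : EucSp N} (hx : x ∈ Ω) (r : ℝ) :
    volume (ccBall X U x r) < ⊤ := by
  obtain ⟨M, hM, hM'⟩ := exists_ccDist_lt_imp_dist_le hX.continuous
    (Bornology.isBounded_singleton (x := x))
  have h0 : volume (ccBall X U x (1 / M)) < ⊤ := by
    refine (measure_mono fun y hy => ?_).trans_lt
      (measure_closedBall_lt_top (μ := volume) (x := x) (r := M * (1 / M)))
    rw [Metric.mem_closedBall, dist_comm]
    exact hM' x rfl _ le_rfl y hy.2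
  have hk : ∀ k : ℕ, volume (ccBall X U x (2 ^ k * (1 / M))) < ⊤ := by
    intro k
    induction k with
    | zero => simpa using h0
    | succ k ih =>
      rw [pow_succ', mul_assoc]
      exact (hX.doubling x hx _ (by positivity)).2.trans_lt
        (ENNReal.mul_lt_top ENNReal.ofReal_lt_top ih)
  obtain ⟨k, hk'⟩ := pow_unbounded_of_one_lt (r * M) (one_lt_two)
  refine (measure_mono (ccBall_mono x ?_)).trans_lt (hk k)
  rw [mul_one_div, le_div_iff₀ hM]
  exact hk'.le

theorem volumeReal_ccBall_pos (hX : XGeometry X Ω U Q CP ν) {x : EucSp N} (hx : x ∈ Ω) {r : ℝ}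
    (hr : 0 < r) : 0 < volume.real (ccBall X U x r) :=
  ENNReal.toReal_pos (hX.volume_ccBall_pos hx hr).ne' (hX.volume_ccBall_lt_top hx r).ne

theorem volumeReal_ccBall_two_mul_le (hX : XGeometry X Ω U Q CP ν) {x : EucSp N} (hx : x ∈ Ω)
    {r : ℝ} (hr : 0 < r) :
    volume.real (ccBall X U x (2 * r)) ≤ 2 ^ Q * volume.real (ccBall X U x r) := by
  have h := ENNReal.toReal_mono (ENNReal.mul_ne_top ENNReal.ofReal_ne_top
    (hX.volume_ccBall_lt_top hx r).ne) (hX.doubling x hx r hr).2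
  rwa [ENNReal.toReal_mul, ENNReal.toReal_ofReal (by positivity)] at h

theorem volumeReal_ccBall_pow_mul_le (hX : XGeometry X Ω U Q CP ν) {x : EucSp N} (hx : x ∈ Ω)
    {r : ℝ} (hr : 0 < r) (k : ℕ) :
    volume.real (ccBall X U x (2 ^ k * r)) ≤ (2 ^ Q) ^ k * volume.real (ccBall X U x r) := by
  induction k with
  | zero => simp
  | succ k ih =>
    rw [pow_succ', mul_assoc, pow_succ', mul_assoc]
    refine (hX.volumeReal_ccBall_two_mul_le hx (by positivity)).trans ?_
    gcongr

/-- `Ω` has finite diameter for the control distance. -/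
theorem exists_ccDist_lt (hX : XGeometry X Ω U Q CP ν) (hΩb : Bornology.IsBounded Ω)
    (hΩU : Ω ⊆ U) :
    ∃ D : ℝ, 0 < D ∧ ∀ x ∈ Ω, ∀ y ∈ Ω, ccDist X x y < ENNReal.ofReal D := by
  rcases Ω.eq_empty_or_nonempty with rfl | ⟨x₀, hx₀⟩
  · exact ⟨1, one_pos, by simp⟩
  obtain ⟨R, hR⟩ := hΩb.subset_closedBall 0
  replace hR : ∀ x ∈ Ω, ‖x‖ ≤ R := fun x hx => by simpa using hR hx
  obtain ⟨δ, hδ, hd⟩ := hX.topology R 1 one_pos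
  -- A finite Euclidean `δ`-net with centres in `Ω` itself: each centre is at finite distance from
  -- `x₀`, and every point of `Ω` is within control distance `1` of a centre.
  obtain ⟨t, htΩ, htf, hcov⟩ := (hΩb.isCompact_closure.totallyBounded.subset
    subset_closure).exists_subset (Metric.dist_mem_uniformity hδ)
  have hex : ∀ c : EucSp N, ∃ D : ℝ, c ∈ Ω → ccDist X x₀ c < ENNReal.ofReal D := by
    intro c
    by_cases hc : c ∈ Ω
    · have := hX.connected x₀ (hΩU hx₀) c (hΩU hc)
      refine ⟨(ccDist X x₀ c).toReal + 1, fun _ => ?_⟩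
      rw [ENNReal.lt_ofReal_iff_toReal_lt this.ne]
      linarith
    · exact ⟨0, fun h => absurd h hc⟩
  choose D hD using hex
  obtain ⟨D₁, hD₁⟩ := (htf.image D).bddAbove
  have h1 : ∀ x ∈ Ω, ccDist X x₀ x < ENNReal.ofReal (max D₁ 0 + 1) := by
    intro x hx
    obtain ⟨c, hc, hxc⟩ := Set.mem_iUnion₂.1 (hcov hx)
    refine ccDist_lt_add hX.continuous ((hD c (htΩ hc)).trans_le (ENNReal.ofReal_le_ofReal
      ((hD₁ ⟨c, hc, rfl⟩).trans (le_max_left _ _)))) ?_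
    refine hd c (hΩU (htΩ hc)) x (hΩU hx) (hR c (htΩ hc)) (hR x hx) ?_
    rw [← dist_eq_norm]; exact hxc
  refine ⟨(max D₁ 0 + 1) + (max D₁ 0 + 1), by positivity, fun x hx y hy => ?_⟩
  exact ccDist_lt_add hX.continuous (ccDist_lt_symm hX.continuous (h1 x hx)) (h1 y hy)

/-- There is a scale at which all control balls centred in `Ω` contain `Ω`. -/
theorem exists_subset_ccBall (hX : XGeometry X Ω U Q CP ν) (hΩb : Bornology.IsBounded Ω)
    (hΩU : Ω ⊆ U) (hν : 0 < ν) :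
    ∃ R : ℝ, 0 < R ∧ ∀ x ∈ Ω, Ω ⊆ ccBall X U x R ∧ Ω ⊆ ccBall X U x (ν * R) := by
  obtain ⟨D, hD, h⟩ := hX.exists_ccDist_lt hΩb hΩU
  refine ⟨D * max 1 (1 / ν), by positivity, fun x hx => ⟨fun y hy => ⟨hΩU hy, ?_⟩,
    fun y hy => ⟨hΩU hy, ?_⟩⟩⟩
  · refine (h x hx y hy).trans_le (ENNReal.ofReal_le_ofReal ?_)
    exact le_mul_of_one_le_right hD.le (le_max_left _ _)
  · refine (h x hx y hy).trans_le (ENNReal.ofReal_le_ofReal ?_)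
    calc D = ν * (D * (1 / ν)) := by field_simp
      _ ≤ _ := by gcongr; exact le_max_right _ _

/-- Iterated doubling from a ball containing `Ω`: this is the lower bound `|B_r| ≥ c r^Q` at dyadic
radii, through which `Q` acts as a dimension. -/
theorem volumeReal_le_of_subset_ccBall (hX : XGeometry X Ω U Q CP ν) {x : EucSp N} (hx : x ∈ Ω)
    {ρ : ℝ} (hρ : 0 < ρ) (hsub : Ω ⊆ ccBall X U x ρ) (k : ℕ) :
    volume.real Ω ≤ (2 ^ Q) ^ k * volume.real (ccBall X U x (ρ / 2 ^ k)) := by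
  refine (measureReal_mono hsub (hX.volume_ccBall_lt_top hx ρ).ne).trans ?_
  have := hX.volumeReal_ccBall_pow_mul_le hx (r := ρ / 2 ^ k) (by positivity) k
  rwa [mul_div_cancel₀ _ (by positivity)] at this

end XGeometry

end Volumes

/-! ### Divergence of Lipschitz vector fields -/

section Divergence

variable {N : ℕ}

/-- The (almost everywhere defined) divergence of a Lipschitz vector field. -/
noncomputable def lipDiv (V : EucSp N → EucSp N) (y : EucSp N) : ℝ :=
  ∑ i, lineDeriv ℝ (fun z => V z i) y (EuclideanSpace.single i 1)

variable {V : EucSp N → EucSp N} {L : ℝ≥0}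

theorem LipschitzWith.euclidean_coord (hV : LipschitzWith L V) (i : Fin N) :
    LipschitzWith L (fun z => V z i) :=
  LipschitzWith.of_dist_le_mul fun x y => by
    refine le_trans ?_ (hV.dist_le_mul x y)
    rw [dist_eq_norm, dist_eq_norm]
    simpa using PiLp.norm_apply_le (V x - V y) i

theorem abs_lipDiv_le (hV : LipschitzWith L V) (y : EucSp N) : |lipDiv V y| ≤ N * L := by
  refine (Finset.abs_sum_le_sum_abs _ _).trans ?_
  have h : ∀ i ∈ (Finset.univ : Finset (Fin N)),
      |lineDeriv ℝ (fun z => V z i) y (EuclideanSpace.single i 1)| ≤ L := fun i _ => by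
    have := norm_lineDeriv_le_of_lipschitz ℝ (hV.euclidean_coord i) (x₀ := y)
      (v := EuclideanSpace.single i 1)
    simpa using this
  refine (Finset.sum_le_sum h).trans ?_
  simp

theorem aestronglyMeasurable_lipDiv (hV : LipschitzWith L V) (μ : Measure (EucSp N)) :
    AEStronglyMeasurable (lipDiv V) μ := by
  unfold lipDiv
  exact Finset.aestronglyMeasurable_fun_sum _ fun i _ =>
    aestronglyMeasurable_lineDeriv (hV.euclidean_coord i).continuous μ

theorem clm_apply_eq_sum_single (T : EucSp N →L[ℝ] ℝ) (w : EucSp N) :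
    T w = ∑ i, w i * T (EuclideanSpace.single i 1) := by
  conv_lhs => rw [← (EuclideanSpace.basisFun (Fin N) ℝ).sum_repr w]
  simp

variable {ψ : EucSp N → ℝ}

theorem integrable_lipDiv_mul (hV : LipschitzWith L V) (hψ : Continuous ψ)
    (hc : HasCompactSupport ψ) (μ : Measure (EucSp N)) [IsFiniteMeasureOnCompacts μ] :
    Integrable (fun y => lipDiv V y * ψ y) μ :=
  (hψ.integrable_of_hasCompactSupport hc).bdd_mul (c := N * L) (aestronglyMeasurable_lipDiv hV μ)
    (Eventually.of_forall fun y => abs_lipDiv_le hV y)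

theorem integrable_fderiv_apply (hV : Continuous V) (hψ : ContDiff ℝ 1 ψ)
    (hc : HasCompactSupport ψ) (μ : Measure (EucSp N)) [IsFiniteMeasureOnCompacts μ] :
    Integrable (fun y => fderiv ℝ ψ y (V y)) μ := by
  have h1 := hψ.continuous_fderiv one_ne_zero
  refine Continuous.integrable_of_hasCompactSupport (by fun_prop) ?_
  exact (hc.fderiv ℝ).mono' fun y hy => by
    refine subset_tsupport _ fun h => hy ?_
    simp [h]

/-- The divergence theorem for a Lipschitz vector field and a compactly supported function. -/
theorem integral_lipDiv_mul_add_fderiv (hV : LipschitzWith L V) (hψ : ContDiff ℝ 1 ψ)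
    (hc : HasCompactSupport ψ) :
    ∫ y, (lipDiv V y * ψ y + fderiv ℝ ψ y (V y)) = 0 := by
  obtain ⟨D, hD⟩ := hψ.lipschitzWith_of_hasCompactSupport hc one_ne_zero
  have hdiff : Differentiable ℝ ψ := hψ.differentiable one_ne_zero
  have hA : ∀ i : Fin N, Integrable fun y =>
      lineDeriv ℝ (fun z => V z i) y (EuclideanSpace.single i 1) * ψ y := fun i =>
    (hψ.continuous.integrable_of_hasCompactSupport hc).bdd_mul (c := L)
      (aestronglyMeasurable_lineDeriv (hV.euclidean_coord i).continuous _)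
      (Eventually.of_forall fun y => by
        simpa using norm_lineDeriv_le_of_lipschitz ℝ (hV.euclidean_coord i) (x₀ := y)
          (v := EuclideanSpace.single i 1))
  have hB : ∀ i : Fin N, Integrable fun y =>
      V y i * fderiv ℝ ψ y (EuclideanSpace.single i 1) := fun i => by
    refine Continuous.integrable_of_hasCompactSupport ?_ ?_
    · exact (hV.euclidean_coord i).continuous.mul
        ((hψ.continuous_fderiv one_ne_zero).clm_apply continuous_const)
    · refine (hc.fderiv_apply ℝ (EuclideanSpace.single i (1 : ℝ))).mono' fun y hy => ?_
      refine subset_tsupport _ fun h => hy ?_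
      simp only [h, mul_zero]
  have key : ∀ i : Fin N, ∫ y, (lineDeriv ℝ (fun z => V z i) y (EuclideanSpace.single i 1) * ψ y
      + V y i * fderiv ℝ ψ y (EuclideanSpace.single i 1)) = 0 := by
    intro i
    have h := (hV.euclidean_coord i).integral_lineDeriv_mul_eq (μ := volume) hD hc
      (EuclideanSpace.single i (1 : ℝ))
    simp_rw [(hdiff _).lineDeriv_eq_fderiv] at h
    have h' : ∫ y, fderiv ℝ ψ y (-EuclideanSpace.single i 1) * V y i
        = -∫ y, V y i * fderiv ℝ ψ y (EuclideanSpace.single i 1) := by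
      rw [← integral_neg]
      refine integral_congr_ae (Eventually.of_forall fun y => ?_)
      simp only [map_neg]
      ring
    rw [integral_add (hA i) (hB i), h, h', neg_add_cancel]
  calc ∫ y, (lipDiv V y * ψ y + fderiv ℝ ψ y (V y))
      = ∫ y, ∑ i, (lineDeriv ℝ (fun z => V z i) y (EuclideanSpace.single i 1) * ψ y
        + V y i * fderiv ℝ ψ y (EuclideanSpace.single i 1)) := by
        refine integral_congr_ae (Eventually.of_forall fun y => ?_)
        simp only [Finset.sum_add_distrib, lipDiv, Finset.sum_mul]
        rw [clm_apply_eq_sum_single (fderiv ℝ ψ y) (V y)]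
    _ = 0 := by
        have hAB : ∀ i : Fin N, Integrable fun y =>
            (lineDeriv ℝ (fun z => V z i) y (EuclideanSpace.single i 1) * ψ y
            + V y i * fderiv ℝ ψ y (EuclideanSpace.single i 1)) := fun i => (hA i).add (hB i)
        rw [integral_finsetSum _ fun i _ => hAB i]
        exact Finset.sum_eq_zero fun i _ => key i

/-- If `1` on the bounded set `Ω` is a limit of test functions whose derivatives along `V`
vanish in the limit, then the divergence theorem holds in `Ωᶜ` without boundary term. -/
theorem setIntegral_compl_lipDiv_mul_add_fderiv {Ω : Set (EucSp N)} (hΩ : MeasurableSet Ω)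
    (hV : LipschitzWith L V) {φ : ℕ → EucSp N → ℝ} (hφ : ∀ n, ContDiff ℝ 1 (φ n))
    (hφc : ∀ n, HasCompactSupport (φ n)) (hφΩ : ∀ n, tsupport (φ n) ⊆ Ω)
    (h1 : Tendsto (fun n => ∫ y in Ω, |φ n y - 1|) atTop (𝓝 0))
    (h2 : Tendsto (fun n => ∫ y in Ω, |fderiv ℝ (φ n) y (V y)|) atTop (𝓝 0))
    (hΩfin : volume Ω ≠ ⊤)
    (hψ : ContDiff ℝ 1 ψ) (hc : HasCompactSupport ψ) :
    ∫ y in Ωᶜ, (lipDiv V y * ψ y + fderiv ℝ ψ y (V y)) = 0 := by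
  set F : EucSp N → ℝ := fun y => lipDiv V y * ψ y + fderiv ℝ ψ y (V y) with hF
  have hFi : ∀ μ : Measure (EucSp N), IsFiniteMeasureOnCompacts μ → Integrable F μ := fun μ _ =>
    (integrable_lipDiv_mul hV hψ.continuous hc μ).add
      (integrable_fderiv_apply hV.continuous hψ hc μ)
  -- The integral over the whole space vanishes by the divergence theorem, so the claim can be moved
  -- to `Ω`, where the functions `φ n` live.
  suffices h : ∫ y in Ω, F y = 0 by
    have h3 := integral_add_compl hΩ (hFi volume inferInstance)
    rw [h, zero_add, hF, integral_lipDiv_mul_add_fderiv hV hψ hc] at h3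
    exact h3
  obtain ⟨Cψ, hCψ⟩ := hψ.continuous.bounded_above_of_compact_support hc
  have hdψ : Continuous fun y => fderiv ℝ ψ y (V y) := by
    have := hψ.continuous_fderiv one_ne_zero
    have := hV.continuous
    fun_prop
  obtain ⟨Cd, hCd⟩ := hdψ.bounded_above_of_compact_support ((hc.fderiv ℝ).mono' fun y hy => by
    refine subset_tsupport _ fun h => hy ?_
    simp [h])
  have hFb : ∀ y, |F y| ≤ N * L * Cψ + Cd := fun y => by
    refine (abs_add_le _ _).trans (add_le_add ?_ (hCd y))
    rw [abs_mul]
    exact mul_le_mul (abs_lipDiv_le hV y) (hCψ y) (abs_nonneg _) (by positivity)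
  have hφi : ∀ n, Integrable (φ n) (volume.restrict Ω) := fun n =>
    ((hφ n).continuous.integrable_of_hasCompactSupport (hφc n))
  have hdi : ∀ n, Integrable (fun y => fderiv ℝ (φ n) y (V y)) (volume.restrict Ω) := fun n =>
    integrable_fderiv_apply hV.continuous (hφ n) (hφc n) _
  have hfin : IsFiniteMeasure (volume.restrict Ω) := isFiniteMeasure_restrict.2 hΩfin
  -- the identity for `φ n * ψ`
  have hid : ∀ n, ∫ y in Ω, φ n y * F y = - ∫ y in Ω, ψ y * fderiv ℝ (φ n) y (V y) := by
    intro n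
    have h3 : ∫ y, (lipDiv V y * (φ n * ψ) y + fderiv ℝ (φ n * ψ) y (V y)) = 0 :=
      integral_lipDiv_mul_add_fderiv hV ((hφ n).mul hψ) ((hφc n).mul_right (f' := ψ))
    have h4 : ∀ y, lipDiv V y * (φ n * ψ) y + fderiv ℝ (φ n * ψ) y (V y)
        = φ n y * F y + ψ y * fderiv ℝ (φ n) y (V y) := fun y => by
      rw [fderiv_mul ((hφ n).differentiable one_ne_zero y) (hψ.differentiable one_ne_zero y)]
      simp [hF]; ring
    simp_rw [h4] at h3
    have h5 : ∫ y in Ω, (φ n y * F y + ψ y * fderiv ℝ (φ n) y (V y)) = 0 := by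
      rw [← h3]
      refine setIntegral_eq_integral_of_forall_compl_eq_zero fun y hy => ?_
      have h6 : y ∉ tsupport (φ n) := fun h => hy (hφΩ n h)
      have h7 : y ∉ tsupport (fderiv ℝ (φ n)) := fun h => h6 (tsupport_fderiv_subset ℝ h)
      simp [image_eq_zero_of_notMem_tsupport h6, image_eq_zero_of_notMem_tsupport h7]
    rw [integral_add ((hφi n).mul_bdd (c := N * L * Cψ + Cd) (hFi _ inferInstance).1
      (Eventually.of_forall hFb)) ((hdi n).bdd_mul (c := Cψ) hψ.continuous.aestronglyMeasurable
      (Eventually.of_forall hCψ))] at h5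
    linarith
  have hlim1 : Tendsto (fun n => ∫ y in Ω, φ n y * F y) atTop (𝓝 0) := by
    simp_rw [hid]
    rw [← neg_zero]
    refine Tendsto.neg (squeeze_zero_norm (fun n => ?_) (by simpa using h2.const_mul Cψ))
    refine (norm_integral_le_integral_norm _).trans ?_
    rw [← integral_const_mul]
    refine integral_mono_of_nonneg (Eventually.of_forall fun _ => norm_nonneg _)
      ((hdi n).abs.const_mul _) (Eventually.of_forall fun y => ?_)
    simp only [norm_mul]
    exact mul_le_mul_of_nonneg_right (hCψ y) (norm_nonneg _)
  -- `F` is bounded, so the `L¹` convergence `φ n → 1` suffices here.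
  have hlim2 : Tendsto (fun n => (∫ y in Ω, φ n y * F y) - ∫ y in Ω, F y) atTop (𝓝 0) := by
    refine squeeze_zero_norm (fun n => ?_) (by simpa using h1.const_mul (N * L * Cψ + Cd))
    rw [← integral_sub ((hφi n).mul_bdd (c := N * L * Cψ + Cd) (hFi _ inferInstance).1
      (Eventually.of_forall hFb)) (hFi _ inferInstance)]
    refine (norm_integral_le_integral_norm _).trans ?_
    rw [← integral_const_mul]
    refine integral_mono_of_nonneg (Eventually.of_forall fun _ => norm_nonneg _)
      (((hφi n).sub (integrable_const 1)).abs.const_mul _) (Eventually.of_forall fun y => ?_)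
    have : φ n y * F y - F y = F y * (φ n y - 1) := by ring
    simp only [this, norm_mul]
    exact mul_le_mul_of_nonneg_right (hFb y) (norm_nonneg _)
  have h8 := hlim1.sub hlim2
  simp only [sub_sub_cancel, sub_zero] at h8
  exact tendsto_nhds_unique tendsto_const_nhds h8

end Divergence

/-! ### Propagation along subunit paths -/

/-- Grönwall's argument: `exp (-c t) f t` is absolutely continuous with nonpositive derivative
almost everywhere. -/
theorem AbsolutelyContinuousOnInterval.nonpos_of_deriv_le_mul {f f' : ℝ → ℝ} {T c : ℝ} (hT : 0 ≤ T)
    (hf : AbsolutelyContinuousOnInterval f 0 T) (h0 : f 0 ≤ 0)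
    (h : ∀ᵐ t, t ∈ Set.Icc 0 T → HasDerivAt f (f' t) t ∧ f' t ≤ c * f t) : f T ≤ 0 := by
  have hE : AbsolutelyContinuousOnInterval (fun t => Real.exp (-c * t)) 0 T :=
    ContDiffOn.absolutelyContinuousOnInterval (by fun_prop)
  have h1 := (hE.mul hf).sub_le_of_ae_deriv_le (C := 0) hT (by
    filter_upwards [h] with t ht hmem
    obtain ⟨h1, h2⟩ := ht hmem
    have h3 : HasDerivAt (fun t => Real.exp (-c * t)) (Real.exp (-c * t) * -c) t := by
      simpa using ((hasDerivAt_id t).const_mul (-c)).exp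
    rw [(h3.mul h1).deriv]
    have := Real.exp_pos (-c * t)
    nlinarith)
  simp only [Pi.mul_apply, mul_zero, Real.exp_zero, one_mul, zero_mul] at h1
  have := Real.exp_pos (-c * T)
  by_contra! hcon
  nlinarith [mul_pos this hcon]

section Bump

variable {N m : ℕ}

/-- A smooth bump of radius `(1 / a) ^ (1 / 2)` around the origin. -/
noncomputable def radialBump (a : ℝ) (z : EucSp N) : ℝ := expNegInvGlue (1 - a * ‖z‖ ^ 2)

theorem contDiff_radialBump {n : ℕ∞} : ContDiff ℝ n fun p : ℝ × EucSp N => radialBump p.1 p.2 := by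
  unfold radialBump
  exact expNegInvGlue.contDiff.comp
    (contDiff_const.sub (contDiff_fst.mul (contDiff_snd.norm_sq ℝ)))

theorem radialBump_nonneg (a : ℝ) (z : EucSp N) : 0 ≤ radialBump a z := expNegInvGlue.nonneg _

theorem radialBump_eq_zero {a : ℝ} {z : EucSp N} (h : 1 ≤ a * ‖z‖ ^ 2) : radialBump a z = 0 :=
  expNegInvGlue.zero_of_nonpos (by linarith)

theorem radialBump_pos {a : ℝ} {z : EucSp N} (h : a * ‖z‖ ^ 2 < 1) : 0 < radialBump a z :=
  expNegInvGlue.pos_of_pos (by linarith)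

theorem hasDerivAt_radialBump {a : ℝ → ℝ} {z : ℝ → EucSp N} {t a' : ℝ} {z' : EucSp N}
    (ha : HasDerivAt a a' t) (hz : HasDerivAt z z' t) :
    HasDerivAt (fun s => radialBump (a s) (z s))
      (-deriv expNegInvGlue (1 - a t * ‖z t‖ ^ 2) * (a' * ‖z t‖ ^ 2 + 2 * a t * inner ℝ (z t) z'))
      t := by
  have h1 : HasDerivAt (fun s => 1 - a s * ‖z s‖ ^ 2)
      (-(a' * ‖z t‖ ^ 2 + a t * (2 * inner ℝ (z t) z'))) t := by
    simpa using (ha.mul hz.norm_sq).const_sub 1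
  have h2 : HasDerivAt expNegInvGlue (deriv expNegInvGlue (1 - a t * ‖z t‖ ^ 2))
      (1 - a t * ‖z t‖ ^ 2) :=
    ((expNegInvGlue.contDiff (n := 1)).differentiable one_ne_zero _).hasDerivAt
  have h3 := h2.comp t h1
  unfold radialBump
  exact h3.congr_deriv (by ring)

theorem fderiv_radialBump_apply (a : ℝ) (c y w : EucSp N) :
    fderiv ℝ (fun y => radialBump a (y - c)) y w
      = -deriv expNegInvGlue (1 - a * ‖y - c‖ ^ 2) * (2 * a * inner ℝ (y - c) w) := by
  have hd : DifferentiableAt ℝ (fun y => radialBump a (y - c)) y := by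
    have h : ContDiff ℝ 1 fun y => radialBump a (y - c) :=
      (contDiff_radialBump (n := 1)).comp (contDiff_const.prodMk (contDiff_id.sub contDiff_const))
    exact h.differentiable one_ne_zero y
  have h1 : HasDerivAt (fun s : ℝ => y + s • w) w 0 := by
    simpa using ((hasDerivAt_id (0 : ℝ)).smul_const w).const_add y
  have h2 : HasDerivAt (fun s : ℝ => radialBump a (y + s • w - c))
      (fderiv ℝ (fun y => radialBump a (y - c)) y w) 0 := by
    have h3 : HasFDerivAt (fun y => radialBump a (y - c))
      (fderiv ℝ (fun y => radialBump a (y - c)) y) (y + (0 : ℝ) • w) := by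
        simpa using hd.hasFDerivAt
    exact h3.comp_hasDerivAt 0 h1
  have h4 := hasDerivAt_radialBump (hasDerivAt_const (0 : ℝ) a) (h1.sub_const c)
  rw [h2.unique h4]
  simp

theorem deriv_expNegInvGlue_nonneg (x : ℝ) : 0 ≤ deriv expNegInvGlue x :=
  expNegInvGlue.monotone.deriv_nonneg

theorem IsSubunitPath.mono {X : Fin m → EucSp N → EucSp N} {T S : ℝ} {γ : ℝ → EucSp N}
    (h : IsSubunitPath X T γ) (hS : 0 ≤ S) (hST : S ≤ T) : IsSubunitPath X S γ := by
  obtain ⟨hac, θ, hθm, hθ⟩ := h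
  refine ⟨hac.mono ?_, θ, hθm, ae_restrict_of_ae_restrict_of_subset
    (Set.Icc_subset_Icc_right hST) hθ⟩
  rw [Set.uIcc_of_le hS, Set.uIcc_of_le (hS.trans hST)]
  exact Set.Icc_subset_Icc_right hST

theorem lipschitzWith_sum_smul {V : Fin m → EucSp N → EucSp N} {L : Fin m → ℝ≥0}
    (hV : ∀ j, LipschitzWith (L j) (V j)) {θ : Fin m → ℝ} (hθ : ∑ j, θ j ^ 2 ≤ 1) :
    LipschitzWith (∑ j, L j) (fun y => ∑ j, θ j • V j y) :=
  LipschitzWith.of_dist_le_mul fun x y => by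
    rw [dist_eq_norm, ← Finset.sum_sub_distrib]
    simp_rw [← smul_sub]
    refine (norm_sum_smul_le hθ _).trans ?_
    push_cast
    rw [Finset.sum_mul]
    refine Finset.sum_le_sum fun j _ => ?_
    rw [← dist_eq_norm]
    exact (hV j).dist_le_mul x y

/-- If the complement of `Ω` has no boundary in the directions of the vector fields `V j`, then
small balls around points of `Ω` that move along a subunit path stay in `Ω` up to null sets. -/
theorem IsSubunitPath.volume_ball_diff_eq_zero {X V : Fin m → EucSp N → EucSp N} {L : Fin m → ℝ≥0}
    {Ω : Set (EucSp N)} (hΩ : MeasurableSet Ω) (hX : ∀ j, Continuous (X j))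
    (hV : ∀ j, LipschitzWith (L j) (V j))
    (hdiv : ∀ θ : Fin m → ℝ, ∑ j, θ j ^ 2 ≤ 1 → ∀ ψ : EucSp N → ℝ, ContDiff ℝ 1 ψ →
      HasCompactSupport ψ → ∫ y in Ωᶜ, (lipDiv (fun y => ∑ j, θ j • V j y) y * ψ y
        + fderiv ℝ ψ y (∑ j, θ j • V j y)) = 0)
    {T : ℝ} (hT : 0 ≤ T) {γ : ℝ → EucSp N} (hγ : IsSubunitPath X T γ)
    (hγV : ∀ t ∈ Set.Icc 0 T, ∀ j, V j (γ t) = X j (γ t)) {r : ℝ} (hr : 0 < r)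
    (h0 : volume (Metric.ball (γ 0) r \ Ω) = 0) :
    volume (Metric.ball (γ T) (r * Real.exp (-(∑ j, L j : ℝ≥0) * T)) \ Ω) = 0 := by
  set Λ : ℝ := ((∑ j, L j : ℝ≥0) : ℝ) with hΛ
  have hΛ0 : 0 ≤ Λ := NNReal.coe_nonneg _
  obtain ⟨K, hK⟩ := hγ.exists_lipschitzOnWith hX hT
  obtain ⟨R, hR⟩ := (isCompact_Icc.image_of_continuousOn (hγ.continuousOn hT)).isBounded.subset_closedBall
    (0 : EucSp N)
  replace hR : ∀ t ∈ Set.Icc 0 T, ‖γ t‖ ≤ R := fun t ht => by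
    simpa using hR ⟨t, ht, rfl⟩
  -- The bump centred at `γ t` has radius `r exp (-Λ t)`. This shrinking compensates for the
  -- variation of the vector field across the bump.
  set a : ℝ → ℝ := fun t => Real.exp (2 * Λ * t) / r ^ 2 with ha
  have ha0 : ∀ t, 0 < a t := fun t => by positivity
  have ha1 : ∀ t, 0 ≤ t → 1 / r ^ 2 ≤ a t := fun t ht => by
    simp only [ha]; gcongr; exact Real.one_le_exp (by positivity)
  have hag : ContDiff ℝ 1 a := by simp only [ha]; fun_prop
  set g : ℝ → EucSp N → ℝ := fun t y => radialBump (a t) (y - γ t) with hg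
  have hgs : ∀ t, ContDiff ℝ 1 (g t) := fun t =>
    (contDiff_radialBump (n := 1)).comp (contDiff_const.prodMk (contDiff_id.sub contDiff_const))
  set B := Metric.closedBall (0 : EucSp N) (R + r) with hB
  have hgB : ∀ t ∈ Set.Icc 0 T, ∀ y, y ∉ B → g t y = 0 := fun t ht y hy => by
    refine radialBump_eq_zero ?_
    have h1 : r ≤ ‖y - γ t‖ := by
      simp only [hB, Metric.mem_closedBall, dist_zero_right, not_le] at hy
      linarith [hR t ht, norm_sub_norm_le y (γ t)]
    calc 1 = 1 / r ^ 2 * r ^ 2 := by field_simp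
      _ ≤ a t * ‖y - γ t‖ ^ 2 := by gcongr; exact ha1 t ht.1
  have hgc : ∀ t ∈ Set.Icc 0 T, HasCompactSupport (g t) := fun t ht =>
    HasCompactSupport.intro (isCompact_closedBall _ _) (hgB t ht)
  set μ := volume.restrict (Ωᶜ ∩ B) with hμ
  have hBfin : volume (Ωᶜ ∩ B) ≠ ⊤ :=
    ((measure_mono Set.inter_subset_right).trans_lt measure_closedBall_lt_top).ne
  have : IsFiniteMeasure μ := isFiniteMeasure_restrict.2 hBfin
  have hmB : ∀ᵐ y ∂μ, y ∈ B :=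
    (ae_restrict_mem (hΩ.compl.inter Metric.isClosed_closedBall.measurableSet)).mono fun _ h => h.2
  have hgi : ∀ t ∈ Set.Icc 0 T, Integrable (g t) μ := fun t ht =>
    (hgs t).continuous.integrable_of_hasCompactSupport (hgc t ht)
  -- uniform Lipschitz continuity in time
  obtain ⟨C, hC⟩ : ∃ C : ℝ≥0, ∀ y ∈ B, LipschitzOnWith C (fun t => g t y) (Set.Icc 0 T) := by
    have hΦ : ContDiff ℝ 1 fun p : ℝ × EucSp N => radialBump (a p.1) p.2 :=
      (contDiff_radialBump (n := 1)).comp ((hag.comp contDiff_fst).prodMk contDiff_snd)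
    obtain ⟨C, hC⟩ := (hΦ.locallyLipschitz.locallyLipschitzOn
      (s := Set.Icc 0 T ×ˢ Metric.closedBall 0 (R + r + R))).exists_lipschitzOnWith_of_compact
      (isCompact_Icc.prod (isCompact_closedBall _ _))
    refine ⟨C * (1 + K), fun y hy => LipschitzOnWith.of_dist_le_mul fun s hs t ht => ?_⟩
    have hmem : ∀ t ∈ Set.Icc 0 T, ((t, y - γ t) : ℝ × EucSp N) ∈
        Set.Icc 0 T ×ˢ Metric.closedBall 0 (R + r + R) := fun t ht => by
      refine ⟨ht, ?_⟩
      simp only [hB, Metric.mem_closedBall, dist_zero_right] at hy ⊢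
      exact (norm_sub_le _ _).trans (add_le_add hy (hR t ht))
    refine (hC.dist_le_mul _ (hmem s hs) _ (hmem t ht)).trans ?_
    push_cast
    rw [mul_assoc]
    refine mul_le_mul_of_nonneg_left ?_ C.2
    rw [Prod.dist_eq, dist_sub_left]
    have h1 := hK.dist_le_mul _ hs _ ht
    have h2 : 0 ≤ K * dist s t := by positivity
    have h3 : 0 ≤ dist s t := dist_nonneg
    refine max_le ?_ ?_ <;> nlinarith
  -- `I t` is the weighted volume of `Ωᶜ` inside the moving ball. It vanishes at time `0`, and the
  -- aim is `I' ≤ N Λ I`, so that it stays zero.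
  set I : ℝ → ℝ := fun t => ∫ y, g t y ∂μ with hI
  have hI0 : ∀ t, 0 ≤ I t := fun t => integral_nonneg fun y => radialBump_nonneg _ _
  have hIac : AbsolutelyContinuousOnInterval I 0 T := by
    refine LipschitzOnWith.absolutelyContinuousOnInterval (K := C * (μ.real Set.univ).toNNReal) ?_
    rw [Set.uIcc_of_le hT]
    refine LipschitzOnWith.of_dist_le_mul fun s hs t ht => ?_
    rw [dist_eq_norm, hI, ← integral_sub (hgi s hs) (hgi t ht)]
    refine (norm_integral_le_of_norm_le_const (C := C * dist s t) ?_).trans_eq ?_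
    · filter_upwards [hmB] with y hy
      rw [← dist_eq_norm]
      exact (hC y hy).dist_le_mul _ hs _ ht
    · push_cast [Real.coe_toNNReal _ measureReal_nonneg]; ring
  have hIderiv : ∀ᵐ t, t ∈ Set.Icc 0 T → ∃ I', HasDerivAt I I' t ∧ I' ≤ (N * Λ) * I t := by
    obtain ⟨-, θ, -, hθ⟩ := hγ
    have hne : ∀ c : ℝ, ∀ᵐ t : ℝ, t ≠ c := fun c => by simp [ae_iff]
    filter_upwards [(ae_restrict_iff' measurableSet_Icc).1 hθ, hne 0, hne T] with t ht ht0 htT hmem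
    obtain ⟨hθ1, hγt⟩ := ht hmem
    set v := ∑ j, θ t j • X j (γ t) with hv
    set W : EucSp N → EucSp N := fun y => ∑ j, θ t j • V j y with hW
    have hWL : LipschitzWith (∑ j, L j) W := lipschitzWith_sum_smul hV hθ1
    have hWv : W (γ t) = v := by simp only [hW, hv, hγV t hmem]
    have hat : HasDerivAt a (2 * Λ * a t) t := by
      have : HasDerivAt (fun t => Real.exp (2 * Λ * t)) (Real.exp (2 * Λ * t) * (2 * Λ)) t := by
        simpa using ((hasDerivAt_id t).const_mul (2 * Λ)).exp
      exact (this.div_const (r ^ 2)).congr_deriv (by simp only [ha]; ring)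
    set d : EucSp N → ℝ := fun y => deriv expNegInvGlue (1 - a t * ‖y - γ t‖ ^ 2) with hd
    have hdc : Continuous d := by
      have : Continuous (deriv expNegInvGlue) :=
        (expNegInvGlue.contDiff (n := 1)).continuous_deriv le_rfl
      exact this.comp (by fun_prop)
    have hgt : ∀ y, HasDerivAt (fun s => g s y)
        (-d y * (2 * Λ * a t * ‖y - γ t‖ ^ 2 + 2 * a t * inner ℝ (y - γ t) (-v))) t := fun y =>
      hasDerivAt_radialBump hat (hγt.const_sub y)
    obtain ⟨hi', hI'⟩ := hasDerivAt_integral_of_dominated_loc_of_lip (μ := μ) (F := g) (x₀ := t)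
      (s := Set.Ioo 0 T) (bound := fun _ => (C : ℝ))
      (Ioo_mem_nhds (lt_of_le_of_ne hmem.1 ht0.symm) (lt_of_le_of_ne hmem.2 htT))
      (Eventually.of_forall fun s => (hgs s).continuous.aestronglyMeasurable) (hgi t hmem)
      (by apply Continuous.aestronglyMeasurable; fun_prop)
      (by
        filter_upwards [hmB] with y hy
        simpa using (hC y hy).mono Set.Ioo_subset_Icc_self)
      (integrable_const _) (Eventually.of_forall hgt)
    refine ⟨_, hI', ?_⟩
    have hWi := integrable_fderiv_apply hWL.continuous (hgs t) (hgc t hmem) μ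
    have hWd := integrable_lipDiv_mul hWL (hgs t).continuous (hgc t hmem) μ
    -- Absence of a boundary term: transport of the bump by `W` costs only `∫ div W · g`, which is
    -- at most `N Λ I`.
    have hz : ∫ y, (lipDiv W y * g t y + fderiv ℝ (g t) y (W y)) ∂μ = 0 := by
      rw [← hdiv (θ t) hθ1 (g t) (hgs t) (hgc t hmem)]
      refine (setIntegral_eq_of_subset_of_forall_sdiff_eq_zero hΩ.compl Set.inter_subset_left
        fun y hy => ?_).symm
      have hyB : y ∉ B := fun h => hy.2 ⟨hy.1, h⟩
      have hts : tsupport (g t) ⊆ B := closure_minimal (fun z hz => by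
        by_contra h; exact hz (hgB t hmem z h)) Metric.isClosed_closedBall
      have h1 : y ∉ tsupport (fderiv ℝ (g t)) := fun h => hyB (hts (tsupport_fderiv_subset ℝ h))
      simp [hgB t hmem y hyB, image_eq_zero_of_notMem_tsupport h1]
    rw [integral_add hWd hWi] at hz
    have hle1 : ∫ y, lipDiv W y * g t y ∂μ ≤ N * Λ * I t := by
      rw [hI, ← integral_const_mul]
      refine integral_mono hWd ((hgi t hmem).const_mul _) fun y => ?_
      exact mul_le_mul_of_nonneg_right (abs_le.1 (abs_lipDiv_le hWL y)).2 (radialBump_nonneg _ _)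
    -- Pointwise, `∂ₜ g ≤ -W · ∇g`: the centre moves with velocity `W (γ t)` rather than `W y`, and
    -- the error `Λ ‖y - γ t‖²` in the inner product is absorbed by the term from the shrinking
    -- radius.
    have hle2 : ∫ y, (-d y * (2 * Λ * a t * ‖y - γ t‖ ^ 2
        + 2 * a t * inner ℝ (y - γ t) (-v))) ∂μ ≤ -∫ y, fderiv ℝ (g t) y (W y) ∂μ := by
      rw [← integral_neg]
      refine integral_mono hi' hWi.neg fun y => ?_
      show _ ≤ -(fderiv ℝ (fun y => radialBump (a t) (y - γ t)) y (W y))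
      rw [fderiv_radialBump_apply]
      have h1 : |inner ℝ (y - γ t) (W y - W (γ t))| ≤ Λ * ‖y - γ t‖ ^ 2 := by
        refine (abs_real_inner_le_norm _ _).trans ?_
        have := hWL.dist_le_mul y (γ t)
        rw [dist_eq_norm, dist_eq_norm] at this
        nlinarith [norm_nonneg (y - γ t)]
      rw [hWv, inner_sub_right] at h1
      have h2 := (abs_le.1 h1).1
      have h3 : 0 ≤ d y := deriv_expNegInvGlue_nonneg _
      have h4 : 0 ≤ d y * a t := mul_nonneg h3 (ha0 t).le
      rw [inner_neg_right]
      show -d y * (2 * Λ * a t * ‖y - γ t‖ ^ 2 + 2 * a t * -inner ℝ (y - γ t) v) ≤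
        -(-d y * (2 * a t * inner ℝ (y - γ t) (W y)))
      nlinarith
    change ∫ y, (-d y * (2 * Λ * a t * ‖y - γ t‖ ^ 2
        + 2 * a t * inner ℝ (y - γ t) (-v))) ∂μ ≤ _
    linarith
  have hIT : I T = 0 := by
    have hc : ∀ t, ∃ I', (t ∈ Set.Icc 0 T → ∃ I', HasDerivAt I I' t ∧ I' ≤ (N * Λ) * I t) →
        (t ∈ Set.Icc 0 T → HasDerivAt I I' t ∧ I' ≤ (N * Λ) * I t) := fun t => by
      by_cases h : t ∈ Set.Icc 0 T ∧ ∃ I', HasDerivAt I I' t ∧ I' ≤ (N * Λ) * I t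
      · obtain ⟨h1, I', h2⟩ := h
        exact ⟨I', fun _ _ => h2⟩
      · exact ⟨0, fun h1 h2 => absurd ⟨h2, h1 h2⟩ h⟩
    choose I' hI' using hc
    refine le_antisymm (hIac.nonpos_of_deriv_le_mul hT (f' := I') ?_ ?_ (c := N * Λ)) (hI0 T)
    · refine (integral_eq_zero_of_ae ?_).le
      have h1 : ∀ᵐ y ∂volume, y ∉ Metric.ball (γ 0) r \ Ω := measure_eq_zero_iff_ae_notMem.1 h0
      rw [hμ, Filter.EventuallyEq, ae_restrict_iff'
        (hΩ.compl.inter Metric.isClosed_closedBall.measurableSet)]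
      filter_upwards [h1] with y hy hyA
      refine radialBump_eq_zero ?_
      have h2 : r ≤ ‖y - γ 0‖ := by
        by_contra! hcon
        exact hy ⟨by rwa [Metric.mem_ball, dist_eq_norm], hyA.1⟩
      calc 1 = 1 / r ^ 2 * r ^ 2 := by field_simp
        _ ≤ a 0 * ‖y - γ 0‖ ^ 2 := by gcongr; exact ha1 0 le_rfl
    · filter_upwards [hIderiv] with t ht
      exact hI' t ht
  have hTm : T ∈ Set.Icc 0 T := ⟨hT, le_rfl⟩
  have hae : ∀ᵐ y ∂μ, g T y = 0 := (integral_eq_zero_iff_of_nonneg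
    (fun y => radialBump_nonneg _ _) (hgi T hTm)).1 hIT
  have h1 : volume ({y | ¬g T y = 0} ∩ (Ωᶜ ∩ B)) = 0 :=
    le_antisymm ((Measure.le_restrict_apply _ _).trans_eq (ae_iff.1 hae)) zero_le
  refine measure_mono_null (fun y hy => ?_) h1
  have h2 : 0 < g T y := by
    refine radialBump_pos ?_
    have h3 : ‖y - γ T‖ < r * Real.exp (-Λ * T) := by
      simpa [dist_eq_norm] using hy.1
    calc a T * ‖y - γ T‖ ^ 2 < a T * (r * Real.exp (-Λ * T)) ^ 2 := by
          have := ha0 T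
          gcongr
      _ = Real.exp (2 * Λ * T) * (Real.exp (-Λ * T)) ^ 2 := by
          simp only [ha]; field_simp
      _ = 1 := by
          rw [← Real.exp_nat_mul, ← Real.exp_add]
          simp; ring
  exact ⟨h2.ne', hy.2, by_contra fun h => h2.ne' (hgB T hTm y h)⟩

end Bump

/-! ### The `X`-gradient of test functions -/

section Gradient

variable {N m : ℕ} {X : Fin m → EucSp N → EucSp N} {φ : EucSp N → ℝ}

theorem xGrad_apply (x : EucSp N) (j : Fin m) : xGrad X φ x j = fderiv ℝ φ x (X j x) := rfl

theorem continuous_xGrad (hX : ∀ j, Continuous (X j)) (hφ : ContDiff ℝ 1 φ) :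
    Continuous (xGrad X φ) := by
  refine (PiLp.continuous_toLp 2 _).comp (continuous_pi fun j => ?_)
  exact (hφ.continuous_fderiv one_ne_zero).clm_apply (hX j)

theorem xGrad_eq_zero_of_notMem_tsupport {x : EucSp N} (hx : x ∉ tsupport φ) : xGrad X φ x = 0 := by
  have h : x ∉ tsupport (fderiv ℝ φ) := fun h => hx (tsupport_fderiv_subset ℝ h)
  ext j
  simp [xGrad_apply, image_eq_zero_of_notMem_tsupport h]

theorem HasCompactSupport.xGrad (hc : HasCompactSupport φ) : HasCompactSupport (xGrad X φ) :=
  hc.mono' fun x hx => by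
    by_contra h
    exact hx (xGrad_eq_zero_of_notMem_tsupport h)

theorem integrable_norm_xGrad (hX : ∀ j, Continuous (X j)) (hφ : ContDiff ℝ 1 φ)
    (hc : HasCompactSupport φ) (μ : Measure (EucSp N)) [IsFiniteMeasureOnCompacts μ] :
    Integrable (fun x => ‖xGrad X φ x‖) μ :=
  ((continuous_xGrad hX hφ).integrable_of_hasCompactSupport hc.xGrad).norm

theorem xGrad_const_smul (c : ℝ) (hφ : Differentiable ℝ φ) (x : EucSp N) :
    xGrad X (fun y => c * φ y) x = c • xGrad X φ x := by
  ext j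
  simp [xGrad_apply, fderiv_const_mul (hφ x)]

theorem abs_fderiv_sum_le {θ : Fin m → ℝ} (hθ : ∑ j, θ j ^ 2 ≤ 1) (x : EucSp N) :
    |fderiv ℝ φ x (∑ j, θ j • X j x)| ≤ m * ‖xGrad X φ x‖ := by
  have h1 := norm_sum_smul_le hθ (fun j => fderiv ℝ φ x (X j x))
  rw [map_sum]
  simp_rw [map_smul]
  refine h1.trans ?_
  have h2 : ∀ j ∈ (Finset.univ : Finset (Fin m)), ‖fderiv ℝ φ x (X j x)‖ ≤ ‖xGrad X φ x‖ :=
    fun j _ => PiLp.norm_apply_le (xGrad X φ x) j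
  refine (Finset.sum_le_sum h2).trans ?_
  simp

/-- Local Lipschitz bounds become uniform on the compact closure of `s`, and the fields extend from
there. The divergence and propagation arguments need global constants. -/
theorem exists_lipschitzWith_eqOn (hX : ∀ j, LocallyLipschitz (X j)) {s : Set (EucSp N)}
    (hs : Bornology.IsBounded s) :
    ∃ (V : Fin m → EucSp N → EucSp N) (L : Fin m → ℝ≥0), ∀ j, LipschitzWith (L j) (V j) ∧
      Set.EqOn (V j) (X j) s := by
  have h : ∀ j, ∃ (V : EucSp N → EucSp N) (L : ℝ≥0), LipschitzWith L V ∧ Set.EqOn V (X j) s := by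
    intro j
    obtain ⟨K, hK⟩ := ((hX j).locallyLipschitzOn
      (s := closure s)).exists_lipschitzOnWith_of_compact hs.isCompact_closure
    obtain ⟨V, hV, hVX⟩ := hK.extend_finite_dimension
    exact ⟨V, _, hV, fun x hx => (hVX (subset_closure hx)).symm⟩
  choose V L hVL using h
  exact ⟨V, L, hVL⟩

/-- `O \ closure s` is open and null, hence empty. -/
theorem subset_closure_of_volume_diff_eq_zero {O s : Set (EucSp N)} (hO : IsOpen O)
    (h : volume (O \ s) = 0) : O ⊆ closure s := by
  have h1 : IsOpen (O \ closure s) := hO.sdiff isClosed_closure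
  have h2 : volume (O \ closure s) = 0 :=
    measure_mono_null (Set.sdiff_subset_sdiff_right subset_closure) h
  rwa [h1.measure_eq_zero_iff (μ := volume), Set.sdiff_eq_empty] at h2

/-- The constant `1` cannot be approximated in `W₀^{1,1}(Ω, X)`. -/
theorem XGeometry.not_tendsto_one {Ω U : Set (EucSp N)} {Q CP ν : ℝ}
    (hX : XGeometry X Ω U Q CP ν) (hN : 0 < N) (hΩ : IsOpen Ω) (hΩb : Bornology.IsBounded Ω)
    (hΩU : Ω ⊆ U) (hne : Ω.Nonempty)
    {φ : ℕ → EucSp N → ℝ} (hφ : ∀ n, ContDiff ℝ 1 (φ n))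
    (hφc : ∀ n, HasCompactSupport (φ n)) (hφΩ : ∀ n, tsupport (φ n) ⊆ Ω)
    (h1 : Tendsto (fun n => ∫ y in Ω, |φ n y - 1|) atTop (𝓝 0))
    (h2 : Tendsto (fun n => ∫ y in Ω, ‖xGrad X (φ n) y‖) atTop (𝓝 0)) : False := by
  have hΩm := hΩ.measurableSet
  have hΩfin : volume Ω ≠ ⊤ := hΩb.measure_lt_top.ne
  have hdiv : ∀ (V : Fin m → EucSp N → EucSp N) (L : Fin m → ℝ≥0),
      (∀ j, LipschitzWith (L j) (V j)) → (∀ j, Set.EqOn (V j) (X j) Ω) →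
      ∀ θ : Fin m → ℝ, ∑ j, θ j ^ 2 ≤ 1 → ∀ ψ : EucSp N → ℝ, ContDiff ℝ 1 ψ →
      HasCompactSupport ψ → ∫ y in Ωᶜ, (lipDiv (fun y => ∑ j, θ j • V j y) y * ψ y
        + fderiv ℝ ψ y (∑ j, θ j • V j y)) = 0 := by
    intro V L hV hVX θ hθ ψ hψ hψc
    refine setIntegral_compl_lipDiv_mul_add_fderiv hΩm (lipschitzWith_sum_smul hV hθ) hφ hφc hφΩ
      h1 ?_ hΩfin hψ hψc
    refine squeeze_zero (fun n => integral_nonneg fun _ => abs_nonneg _) (fun n => ?_)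
      (by simpa using h2.const_mul (m : ℝ))
    rw [← integral_const_mul]
    refine integral_mono_of_nonneg (Eventually.of_forall fun _ => abs_nonneg _)
      ((integrable_norm_xGrad hX.continuous (hφ n) (hφc n) _).const_mul _) ?_
    filter_upwards [ae_restrict_mem hΩm] with y hy
    have : ∑ j, θ j • V j y = ∑ j, θ j • X j y :=
      Finset.sum_congr rfl fun j _ => by rw [hVX j hy]
    rw [this]
    exact abs_fderiv_sum_le hθ y
  -- subunit paths starting in `Ω` stay in the closure of `Ω`
  have hstay : ∀ T : ℝ, 0 ≤ T → ∀ γ, IsSubunitPath X T γ → γ 0 ∈ Ω → γ T ∈ closure Ω := by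
    intro T hT γ hγ hγ0
    obtain ⟨r, hr, hrΩ⟩ := Metric.isOpen_iff.1 hΩ _ hγ0
    obtain ⟨V, L, hVL⟩ := exists_lipschitzWith_eqOn hX.lipschitz
      (hΩb.union (isCompact_Icc.image_of_continuousOn (hγ.continuousOn hT)).isBounded)
    have h3 := hγ.volume_ball_diff_eq_zero hΩm hX.continuous (fun j => (hVL j).1)
      (hdiv V L (fun j => (hVL j).1) fun j => (hVL j).2.mono Set.subset_union_left) hT
      (fun t ht j => (hVL j).2 (Or.inr ⟨t, ht, rfl⟩)) hr (by rw [Set.sdiff_eq_empty.2 hrΩ]; simp)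
    exact subset_closure_of_volume_diff_eq_zero Metric.isOpen_ball h3
      (Metric.mem_ball_self (by positivity))
  obtain ⟨x₀, hx₀⟩ := hne
  obtain ⟨r, hr, hrΩ⟩ := Metric.isOpen_iff.1 hΩ _ hx₀
  obtain ⟨D, hD, hdist⟩ := hX.exists_ccDist_lt hΩb hΩU
  -- In `hstay` the Lipschitz constants depended on the path. Now that paths are confined to
  -- `closure Ω`, one extension serves all of them, and the radius `ρ` is uniform over `Ω`.
  obtain ⟨V, L, hVL⟩ := exists_lipschitzWith_eqOn hX.lipschitz hΩb.closure
  set Λ : ℝ := ((∑ j, L j : ℝ≥0) : ℝ) with hΛ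
  set ρ := r * Real.exp (-Λ * D) with hρ
  have hρ0 : 0 < ρ := by positivity
  have hball : ∀ x ∈ Ω, Metric.ball x ρ ⊆ closure Ω := by
    intro x hx
    obtain ⟨T, hT, hTD, γ, hγ, h0, rfl⟩ := ccDist_lt_ofReal_iff.1 (hdist x₀ hx₀ x hx)
    have h3 := hγ.volume_ball_diff_eq_zero hΩm hX.continuous (fun j => (hVL j).1)
      (hdiv V L (fun j => (hVL j).1) fun j => (hVL j).2.mono subset_closure) hT.le
      (fun t ht j => (hVL j).2 (hstay t ht.1 γ (hγ.mono ht.1 ht.2) (h0 ▸ hx₀))) hr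
      (by rw [h0, Set.sdiff_eq_empty.2 hrΩ]; simp)
    refine Set.Subset.trans (Metric.ball_subset_ball ?_)
      (subset_closure_of_volume_diff_eq_zero Metric.isOpen_ball h3)
    rw [hρ]
    gcongr ?_ * Real.exp ?_
    have : 0 ≤ Λ := NNReal.coe_nonneg _
    nlinarith
  have hopen : IsOpen (closure Ω) := by
    rw [Metric.isOpen_iff]
    intro x hx
    obtain ⟨z, hz, hxz⟩ := Metric.mem_closure_iff.1 hx (ρ / 2) (by linarith)
    refine ⟨ρ / 2, by linarith, fun y hy => hball z hz ?_⟩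
    rw [Metric.mem_ball] at hy ⊢
    linarith [dist_triangle y x z]
  have huniv : closure Ω = Set.univ :=
    IsClopen.eq_univ ⟨isClosed_closure, hopen⟩ ⟨x₀, subset_closure hx₀⟩
  have : Nonempty (Fin N) := ⟨⟨0, hN⟩⟩
  exact NormedSpace.unbounded_univ ℝ (EucSp N) (huniv ▸ hΩb.closure)

end Gradient

/-! ### The Friedrichs inequality in `L¹` -/

section Friedrichs

variable {N m : ℕ} {X : Fin m → EucSp N → EucSp N} {Ω U : Set (EucSp N)} {Q CP ν : ℝ}

/-- The integral of the `X`-gradient of a test function over `s` is at most that over `Ω`. -/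
theorem setIntegral_norm_xGrad_le (hX : ∀ j, Continuous (X j)) {φ : EucSp N → ℝ}
    (hφ : ContDiff ℝ 1 φ) (hc : HasCompactSupport φ) (hφΩ : tsupport φ ⊆ Ω) (s : Set (EucSp N)) :
    ∫ y in s, ‖xGrad X φ y‖ ≤ ∫ y in Ω, ‖xGrad X φ y‖ := by
  rw [setIntegral_eq_integral_of_forall_compl_eq_zero (s := Ω) fun y hy => by
    rw [xGrad_eq_zero_of_notMem_tsupport fun h => hy (hφΩ h), norm_zero]]
  exact setIntegral_le_integral (integrable_norm_xGrad hX hφ hc _)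
    (Eventually.of_forall fun _ => norm_nonneg _)

namespace XGeometry

theorem integral_abs_sub_average_le (hX : XGeometry X Ω U Q CP ν) {x : EucSp N} (hx : x ∈ Ω) {r : ℝ}
    (hr : 0 < r) {φ : EucSp N → ℝ} (hφ : ContDiff ℝ 1 φ) (hc : HasCompactSupport φ) :
    (volume.real (ccBall X U x r))⁻¹ * ∫ y in ccBall X U x r, |φ y - ⨍ z in ccBall X U x r, φ z|
      ≤ CP * r * ((volume.real (ccBall X U x (ν * r)))⁻¹ *
        ∫ y in ccBall X U x (ν * r), ‖xGrad X φ y‖) := by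
  have := hX.poincare x hx r hr φ hφ hc
  rw [setAverage_eq _ (fun y => |φ y - _|), setAverage_eq _ (fun y => ‖xGrad X φ y‖)] at this
  simpa only [smul_eq_mul] using this

/-- Poincaré on a ball containing `Ω` controls the oscillation; the remaining constants are excluded
by contradiction through `not_tendsto_one`, so `C` is not explicit. -/
theorem exists_integral_abs_le (hX : XGeometry X Ω U Q CP ν) (hN : 0 < N) (hΩ : IsOpen Ω)
    (hΩb : Bornology.IsBounded Ω) (hΩU : Ω ⊆ U) (hν : 0 < ν) (hCP : 0 < CP) :
    ∃ C : ℝ, 0 ≤ C ∧ ∀ φ : EucSp N → ℝ, ContDiff ℝ 1 φ → HasCompactSupport φ → tsupport φ ⊆ Ω →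
      ∫ y in Ω, |φ y| ≤ C * ∫ y in Ω, ‖xGrad X φ y‖ := by
  rcases Ω.eq_empty_or_nonempty with rfl | hne
  · exact ⟨0, le_rfl, fun φ _ _ _ => by simp⟩
  have hΩm := hΩ.measurableSet
  have hΩfin : volume Ω ≠ ⊤ := hΩb.measure_lt_top.ne
  have hω : 0 < volume.real Ω := ENNReal.toReal_pos (hΩ.measure_pos volume hne).ne' hΩfin
  obtain ⟨x₀, hx₀⟩ := hne
  obtain ⟨R, hR, hRΩ⟩ := hX.exists_subset_ccBall hΩb hΩU hν
  obtain ⟨C₀, hC₀, hosc⟩ : ∃ C₀ : ℝ, 0 < C₀ ∧ ∀ φ : EucSp N → ℝ, ContDiff ℝ 1 φ →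
      HasCompactSupport φ → tsupport φ ⊆ Ω →
      ∃ c : ℝ, ∫ y in Ω, |φ y - c| ≤ C₀ * ∫ y in Ω, ‖xGrad X φ y‖ := by
    have hV := hX.volumeReal_ccBall_pos hx₀ hR
    have hV' := hX.volumeReal_ccBall_pos hx₀ (mul_pos hν hR)
    refine ⟨volume.real (ccBall X U x₀ R) * (CP * R * (volume.real (ccBall X U x₀ (ν * R)))⁻¹),
      by positivity, fun φ hφ hc hφΩ => ⟨⨍ z in ccBall X U x₀ R, φ z, ?_⟩⟩
    have h1 := hX.integral_abs_sub_average_le hx₀ hR hφ hc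
    rw [inv_mul_le_iff₀ hV] at h1
    have hfin : IsFiniteMeasure (volume.restrict (ccBall X U x₀ R)) :=
      isFiniteMeasure_restrict.2 (hX.volume_ccBall_lt_top hx₀ R).ne
    have h2 : ∫ y in Ω, |φ y - ⨍ z in ccBall X U x₀ R, φ z|
        ≤ ∫ y in ccBall X U x₀ R, |φ y - ⨍ z in ccBall X U x₀ R, φ z| := by
      refine setIntegral_mono_set ?_ (Eventually.of_forall fun _ => abs_nonneg _)
        (hRΩ x₀ hx₀).1.eventuallyLE
      exact (((hφ.continuous.integrable_of_hasCompactSupport hc)).sub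
        (integrable_const (μ := volume.restrict (ccBall X U x₀ R)) _)).abs
    refine (h2.trans h1).trans ?_
    rw [mul_assoc (volume.real _), mul_assoc (CP * R)]
    exact mul_le_mul_of_nonneg_left (mul_le_mul_of_nonneg_left (mul_le_mul_of_nonneg_left
      (setIntegral_norm_xGrad_le hX.continuous hφ hc hφΩ _) (by positivity)) (by positivity)) hV.le
  by_contra! hcon
  -- With `n₀ > 2 C₀` the oscillation is at most half of `∫|φ n|`, so the subtracted constant `c n`
  -- carries the rest; in particular it is nonzero and can be divided by.
  obtain ⟨n₀, hn₀⟩ := exists_nat_gt (2 * C₀)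
  have hn₀' : (0 : ℝ) < n₀ := by linarith
  choose φ hφ hc hφΩ hlt using fun n : ℕ => hcon (n + n₀ : ℝ) (by positivity)
  choose c hcb using fun n => hosc (φ n) (hφ n) (hc n) (hφΩ n)
  set a : ℕ → ℝ := fun n => ∫ y in Ω, |φ n y| with ha
  set b : ℕ → ℝ := fun n => ∫ y in Ω, ‖xGrad X (φ n) y‖ with hb
  have hb0 : ∀ n, 0 ≤ b n := fun n => integral_nonneg fun _ => norm_nonneg _
  have hab : ∀ n, (n + n₀) * b n < a n := hlt
  have hfin : IsFiniteMeasure (volume.restrict Ω) := isFiniteMeasure_restrict.2 hΩfin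
  have hφi : ∀ n, Integrable (φ n) (volume.restrict Ω) := fun n =>
    (hφ n).continuous.integrable_of_hasCompactSupport (hc n)
  have hca : ∀ n, a n ≤ 2 * (volume.real Ω * |c n|) := fun n => by
    have h1 : a n ≤ ∫ y in Ω, (|φ n y - c n| + |c n|) :=
      integral_mono (hφi n).abs
        (((hφi n).sub (integrable_const (c n))).abs.add (integrable_const |c n|)) fun y => by
          have := abs_add_le (φ n y - c n) (c n)
          simpa using this
    have hi : Integrable (fun y => |φ n y - c n|) (volume.restrict Ω) :=
      ((hφi n).sub (integrable_const _)).abs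
    rw [integral_add hi (integrable_const _)] at h1
    simp only [integral_const, measureReal_restrict_apply_univ, smul_eq_mul] at h1
    have h2 := hcb n
    have h3 := hab n
    have h4 : 2 * C₀ * b n ≤ n₀ * b n := mul_le_mul_of_nonneg_right hn₀.le (hb0 n)
    have h5 : 0 ≤ n * b n := mul_nonneg n.cast_nonneg (hb0 n)
    change ∫ y in Ω, |φ n y - c n| ≤ C₀ * b n at h2
    nlinarith
  have ha0 : ∀ n, 0 < a n := fun n => lt_of_le_of_lt (by have := hb0 n; positivity) (hab n)
  have hc0 : ∀ n, 0 < |c n| := fun n => by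
    have := ha0 n
    have h2 := hca n
    by_contra! h
    have : |c n| = 0 := le_antisymm h (abs_nonneg _)
    rw [this] at h2
    linarith [ha0 n]
  have hbc : ∀ n, b n / |c n| ≤ 2 * volume.real Ω * (1 / ((n : ℝ) + 1)) := fun n => by
    have hn1 : (1 : ℝ) ≤ n₀ := by exact_mod_cast Nat.one_le_iff_ne_zero.2 (by
      rintro rfl; simp at hn₀')
    rw [div_le_iff₀ (hc0 n), mul_one_div, div_mul_eq_mul_div, le_div_iff₀ (by positivity)]
    have h1 := hab n
    have h2 := hca n
    have h3 := hb0 n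
    nlinarith
  have hlim : Tendsto (fun n => b n / |c n|) atTop (𝓝 0) := by
    have h := (tendsto_one_div_add_atTop_nhds_zero_nat (𝕜 := ℝ)).const_mul (2 * volume.real Ω)
    rw [mul_zero] at h
    exact squeeze_zero (fun n => div_nonneg (hb0 n) (abs_nonneg _)) hbc h
  refine hX.not_tendsto_one hN hΩ hΩb hΩU ⟨x₀, hx₀⟩ (φ := fun n y => (c n)⁻¹ * φ n y)
    (fun n => contDiff_const.mul (hφ n)) (fun n => (hc n).mul_left) (fun n => ?_) ?_ ?_
  · exact (closure_mono (Function.support_mul_subset_right _ _)).trans (hφΩ n)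
  · refine squeeze_zero (fun n => integral_nonneg fun _ => abs_nonneg _) (fun n => ?_)
      (by simpa using hlim.const_mul C₀)
    rw [← mul_div_assoc, le_div_iff₀ (hc0 n), mul_comm, ← integral_const_mul]
    refine le_trans (le_of_eq ?_) (hcb n)
    refine integral_congr_ae (Eventually.of_forall fun y => ?_)
    have : c n ≠ 0 := abs_pos.1 (hc0 n)
    simp only [← abs_mul]
    congr 1
    field_simp
  · refine hlim.congr fun n => ?_
    rw [hb, div_eq_inv_mul, ← integral_const_mul]
    refine integral_congr_ae (Eventually.of_forall fun y => ?_)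
    simp only [xGrad_const_smul _ ((hφ n).differentiable one_ne_zero), norm_smul, norm_inv,
      Real.norm_eq_abs]

end XGeometry

end Friedrichs

/-! ### A weak Sobolev inequality for test functions -/

/-- The growing bound is summed up to `k`, the decaying one from `k` on; each geometric series is
dominated by its term at the crossing index. -/
theorem sum_range_le_of_le_min {c : ℕ → ℝ} {s H τ : ℝ} (hτ : 1 < τ) (hs : 0 ≤ s)
    (hH : 0 ≤ H) (h1 : ∀ i, c i ≤ s / 2 ^ i) (h2 : ∀ i, c i ≤ τ ^ i * H) (k n : ℕ) :
    ∑ i ∈ Finset.range n, c i ≤ τ ^ k * H / (τ - 1) + 2 * (s / 2 ^ k) := by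
  have hτ1 : 0 < τ - 1 := by linarith
  have A : ∀ n, ∑ i ∈ Finset.range n, c i ≤ τ ^ n * H / (τ - 1) := by
    intro n
    induction n with
    | zero => simp; positivity
    | succ n ih =>
      rw [Finset.sum_range_succ]
      calc _ ≤ τ ^ n * H / (τ - 1) + τ ^ n * H := add_le_add ih (h2 n)
        _ = τ ^ (n + 1) * H / (τ - 1) := by field_simp; ring
  rcases le_total n k with hnk | hkn
  · refine (A n).trans ?_
    have : τ ^ n * H / (τ - 1) ≤ τ ^ k * H / (τ - 1) := by
      gcongr
      exact hτ.le
    have : 0 ≤ 2 * (s / 2 ^ k) := by positivity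
    linarith
  -- The remaining tail `2 s / 2^n` is kept in the statement so that the induction closes.
  · have B : ∑ i ∈ Finset.range n, c i ≤ τ ^ k * H / (τ - 1) + 2 * (s / 2 ^ k) - 2 * (s / 2 ^ n) := by
      induction n, hkn using Nat.le_induction with
      | base => linarith [A k]
      | succ n _ ih =>
        rw [Finset.sum_range_succ]
        have e : 2 * (s / 2 ^ (n + 1)) = s / 2 ^ n := by rw [pow_succ]; field_simp
        have := h1 n
        linarith
    have : 0 ≤ 2 * (s / 2 ^ n) := by positivity
    linarith

/-- Cauchy–Schwarz against the constant `1`, obtained by expanding `∫ (V g - I)² ≥ 0`. -/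
theorem sq_setIntegral_le {α : Type*} [MeasurableSpace α] {μ : Measure α} {s : Set α}
    (hs : μ s ≠ ⊤) {g : α → ℝ} (hg : IntegrableOn g s μ) (hg2 : IntegrableOn (fun x => g x ^ 2) s μ) :
    (∫ x in s, g x ∂μ) ^ 2 ≤ μ.real s * ∫ x in s, g x ^ 2 ∂μ := by
  have hfin : IsFiniteMeasure (μ.restrict s) := isFiniteMeasure_restrict.2 hs
  set V := μ.real s with hV
  set I := ∫ x in s, g x ∂μ with hI
  have hV0 : 0 ≤ V := measureReal_nonneg
  have h : 0 ≤ ∫ x in s, (V ^ 2 * g x ^ 2 - 2 * V * I * g x + I ^ 2) ∂μ :=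
    integral_nonneg fun x => by
      have : V ^ 2 * g x ^ 2 - 2 * V * I * g x + I ^ 2 = (V * g x - I) ^ 2 := by ring
      rw [Pi.zero_apply, this]; positivity
  have hi : IntegrableOn (fun x => V ^ 2 * g x ^ 2 - 2 * V * I * g x) s μ :=
    (hg2.const_mul _).sub (hg.const_mul _)
  rw [integral_add hi (integrable_const _), integral_sub (hg2.const_mul _) (hg.const_mul _), integral_const_mul, integral_const_mul,
    integral_const, measureReal_restrict_apply_univ, ← hV, ← hI, smul_eq_mul] at h
  rcases hV0.eq_or_lt with h0 | h0
  · have : μ s = 0 := by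
      rw [hV, measureReal_def, eq_comm, ENNReal.toReal_eq_zero_iff] at h0
      exact h0.resolve_right hs
    have : I = 0 := by rw [hI, Measure.restrict_eq_zero.2 this]; simp
    rw [this, ← h0]; simp
  · have h3 : 0 ≤ V * (V * (∫ x in s, g x ^ 2 ∂μ) - I ^ 2) := by nlinarith
    have := nonneg_of_mul_nonneg_right h3 h0
    linarith

section Sobolev

variable {N m : ℕ} {X : Fin m → EucSp N → EucSp N} {Ω U : Set (EucSp N)} {Q CP ν : ℝ}

theorem integrable_norm_xGrad_sq (hX : ∀ j, Continuous (X j)) {φ : EucSp N → ℝ}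
    (hφ : ContDiff ℝ 1 φ) (hc : HasCompactSupport φ) (μ : Measure (EucSp N))
    [IsFiniteMeasureOnCompacts μ] : Integrable (fun y => ‖xGrad X φ y‖ ^ 2) μ := by
  refine Continuous.integrable_of_hasCompactSupport ((continuous_xGrad hX hφ).norm.pow 2) ?_
  exact (HasCompactSupport.xGrad (X := X) hc).mono' fun y hy => by
    refine subset_tsupport _ fun h => hy ?_
    simp [show xGrad X φ y = 0 from h]

namespace XGeometry

/-- Weak type `(1,1)` bound for the dyadic maximal function of `η`. Vitali selects disjoint balls;
each ball in the family meets a selected one of at least half its radius. A centre is thus within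
three selected radii, so the eightfold enlargements cover, at the price of three doublings. -/
theorem mul_volume_le_of_forall_exists (hX : XGeometry X Ω U Q CP ν) (hU : IsOpen U) (hΩU : Ω ⊆ U)
    {ρ : ℝ} (hρ : 0 < ρ) (η : Measure (EucSp N)) (c : ℝ≥0∞) :
    c * volume {x | x ∈ Ω ∧ ∃ i : ℕ, c * volume (ccBall X U x (ρ / 2 ^ i))
      ≤ η (ccBall X U x (ρ / 2 ^ i))} ≤ ENNReal.ofReal (2 ^ Q) ^ 3 * η Set.univ := by
  set B : EucSp N × ℕ → Set (EucSp N) := fun p => ccBall X U p.1 (ρ / 2 ^ p.2) with hB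
  set t : Set (EucSp N × ℕ) := {p | p.1 ∈ Ω ∧ c * volume (B p) ≤ η (B p)} with ht
  have hBne : ∀ p ∈ t, (B p).Nonempty := fun p hp =>
    ⟨p.1, mem_ccBall_self (hΩU hp.1) (by positivity)⟩
  have hBo : ∀ p, IsOpen (B p) := fun p => hX.isOpen_ccBall hU _ _
  obtain ⟨u, hut, hdisj, hcov⟩ := Vitali.exists_disjoint_subfamily_covering_enlargement B t
    (fun p => ρ / 2 ^ p.2) 2 one_lt_two (fun p _ => by positivity) ρ
    (fun p _ => div_le_self hρ.le (one_le_pow₀ one_le_two)) hBne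
  have huc : u.Countable := hdisj.countable_of_isOpen (fun p _ => hBo p) fun p hp => hBne p (hut hp)
  have hsub : {x | x ∈ Ω ∧ ∃ i : ℕ, c * volume (ccBall X U x (ρ / 2 ^ i))
      ≤ η (ccBall X U x (ρ / 2 ^ i))} ⊆ ⋃ p ∈ u, ccBall X U p.1 (2 * (2 * (2 * (ρ / 2 ^ p.2)))) := by
    rintro x ⟨hx, i, hi⟩
    obtain ⟨p, hp, ⟨z, hz1, hz2⟩, hle⟩ := hcov (x, i) ⟨hx, hi⟩
    refine Set.mem_iUnion₂.2 ⟨p, hp, hΩU hx, ?_⟩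
    refine (ccDist_lt_add hX.continuous hz2.2 (ccDist_lt_symm hX.continuous hz1.2)).trans_le
      (ENNReal.ofReal_le_ofReal ?_)
    have : 0 < ρ / 2 ^ p.2 := by positivity
    simp only at hle ⊢
    linarith
  have hdoub : ∀ p ∈ u, volume (ccBall X U p.1 (2 * (2 * (2 * (ρ / 2 ^ p.2)))))
      ≤ ENNReal.ofReal (2 ^ Q) ^ 3 * volume (B p) := fun p hp => by
    have hp1 := (hut hp).1
    have hpos : 0 < ρ / 2 ^ p.2 := by positivity
    have h1 := (hX.doubling p.1 hp1 _ hpos).2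
    have h2 := (hX.doubling p.1 hp1 (2 * (ρ / 2 ^ p.2)) (by linarith)).2
    have h3 := (hX.doubling p.1 hp1 (2 * (2 * (ρ / 2 ^ p.2))) (by linarith)).2
    rw [pow_succ', pow_two, mul_assoc, mul_assoc]
    exact h3.trans (mul_le_mul_right (h2.trans (mul_le_mul_right h1 _)) _)
  have : Countable u := huc.to_subtype
  calc _ ≤ c * ∑' p : u, volume (ccBall X U p.1.1 (2 * (2 * (2 * (ρ / 2 ^ p.1.2))))) := by
        gcongr
        refine (measure_mono hsub).trans ?_
        rw [Set.biUnion_eq_iUnion]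
        exact measure_iUnion_le _
    _ ≤ c * ∑' p : u, ENNReal.ofReal (2 ^ Q) ^ 3 * volume (B p) := by
        gcongr with p
        exact hdoub p p.2
    _ = ENNReal.ofReal (2 ^ Q) ^ 3 * ∑' p : u, c * volume (B p) := by
        rw [ENNReal.tsum_mul_left, ENNReal.tsum_mul_left]; ring
    _ ≤ ENNReal.ofReal (2 ^ Q) ^ 3 * ∑' p : u, η (B p) := by
        gcongr with p
        exact (hut p.2).2
    _ ≤ ENNReal.ofReal (2 ^ Q) ^ 3 * η Set.univ := by
        gcongr
        rw [← measure_biUnion huc hdisj fun p _ => (hBo p).measurableSet]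
        exact measure_mono (Set.subset_univ _)

/-- Averages of a continuous function over shrinking control balls converge. -/
theorem tendsto_average_ccBall (hX : XGeometry X Ω U Q CP ν) {x : EucSp N} (hx : x ∈ Ω) {R : ℝ}
    (hR : 0 < R) {φ : EucSp N → ℝ} (hφ : Continuous φ) (hφi : Integrable φ) :
    Tendsto (fun i : ℕ => ⨍ y in ccBall X U x (R / 2 ^ i), φ y) atTop (𝓝 (φ x)) := by
  obtain ⟨M, hM, hM'⟩ := exists_ccDist_lt_imp_dist_le hX.continuous
    (Bornology.isBounded_singleton (x := x))
  rw [Metric.tendsto_nhds]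
  intro ε hε
  obtain ⟨δ, hδ, hd⟩ := Metric.continuous_iff.1 hφ x (ε / 2) (by linarith)
  have hlim : Tendsto (fun i : ℕ => R / 2 ^ i) atTop (𝓝 0) := by
    have h := (tendsto_pow_atTop_nhds_zero_of_lt_one (r := (1 / 2 : ℝ)) (by norm_num)
      (by norm_num)).const_mul R
    rw [mul_zero] at h
    refine h.congr fun i => ?_
    rw [div_pow, one_pow, mul_one_div]
  filter_upwards [hlim.eventually_lt_const (show 0 < min (1 / M) (δ / M) by positivity)] with i hi
  obtain ⟨hi1, hi2⟩ := lt_min_iff.1 hi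
  set B := ccBall X U x (R / 2 ^ i) with hB
  have hV : 0 < volume.real B := hX.volumeReal_ccBall_pos hx (by positivity)
  have hfin := hX.volume_ccBall_lt_top hx (R / 2 ^ i)
  have : IsFiniteMeasure (volume.restrict B) := isFiniteMeasure_restrict.2 hfin.ne
  have hb : ∀ y ∈ B, ‖φ y - φ x‖ ≤ ε / 2 := fun y hy => by
    refine (hd y ?_).le
    rw [dist_comm]
    refine (hM' x rfl _ hi1.le y hy.2).trans_lt ?_
    rwa [lt_div_iff₀ hM, mul_comm] at hi2
  have h1 := norm_setIntegral_le_of_norm_le_const hfin hb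
  rw [integral_sub hφi.integrableOn (integrable_const _), integral_const,
    measureReal_restrict_apply_univ, smul_eq_mul] at h1
  rw [setAverage_eq, smul_eq_mul, dist_eq_norm]
  have h2 : (volume.real B)⁻¹ * (∫ y in B, φ y) - φ x
      = (volume.real B)⁻¹ * ((∫ y in B, φ y) - volume.real B * φ x) := by
    field_simp
  rw [h2, norm_mul, norm_inv, Real.norm_of_nonneg hV.le, inv_mul_lt_iff₀ hV]
  refine h1.trans_lt ?_
  rw [mul_comm]
  exact mul_lt_mul_of_pos_left (by linarith) hV

/-- The smaller average is compared with the constant `u` by enlarging the domain of integration;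
doubling pays for the change of volume, and Poincaré applies on the larger ball. -/
theorem abs_average_succ_sub_le (hX : XGeometry X Ω U Q CP ν) {x : EucSp N}
    (hx : x ∈ Ω) {r : ℝ} (hr : 0 < r) {φ : EucSp N → ℝ} (hφ : ContDiff ℝ 1 φ)
    (hc : HasCompactSupport φ) :
    |(⨍ y in ccBall X U x r, φ y) - ⨍ y in ccBall X U x (2 * r), φ y|
      ≤ 2 ^ Q * (CP * (2 * r) * ((volume.real (ccBall X U x (ν * (2 * r))))⁻¹ *
        ∫ y in ccBall X U x (ν * (2 * r)), ‖xGrad X φ y‖)) := by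
  set u := ⨍ y in ccBall X U x (2 * r), φ y with hu
  have hφi : Integrable φ := hφ.continuous.integrable_of_hasCompactSupport hc
  have hV := hX.volumeReal_ccBall_pos hx hr
  have hV2 := hX.volumeReal_ccBall_pos hx (r := 2 * r) (by linarith)
  have hfin : IsFiniteMeasure (volume.restrict (ccBall X U x r)) :=
    isFiniteMeasure_restrict.2 (hX.volume_ccBall_lt_top hx r).ne
  have hfin2 : IsFiniteMeasure (volume.restrict (ccBall X U x (2 * r))) :=
    isFiniteMeasure_restrict.2 (hX.volume_ccBall_lt_top hx (2 * r)).ne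
  have hP := hX.integral_abs_sub_average_le hx (r := 2 * r) (by linarith) hφ hc
  refine le_trans ?_ (mul_le_mul_of_nonneg_left hP (by positivity))
  rw [← hu]
  have h1 : (⨍ y in ccBall X U x r, φ y) - u
      = (volume.real (ccBall X U x r))⁻¹ * ∫ y in ccBall X U x r, (φ y - u) := by
    rw [integral_sub hφi.integrableOn (integrable_const _), integral_const,
      measureReal_restrict_apply_univ, smul_eq_mul, setAverage_eq, smul_eq_mul]
    field_simp
  have h2 : |∫ y in ccBall X U x r, (φ y - u)| ≤ ∫ y in ccBall X U x (2 * r), |φ y - u| := by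
    refine (abs_integral_le_integral_abs).trans ?_
    refine setIntegral_mono_set ?_ (Eventually.of_forall fun _ => abs_nonneg _)
      (ccBall_mono x (by linarith)).eventuallyLE
    exact (hφi.integrableOn.sub (integrable_const _)).abs
  have h3 : (volume.real (ccBall X U x r))⁻¹ ≤ 2 ^ Q * (volume.real (ccBall X U x (2 * r)))⁻¹ := by
    rw [← div_eq_mul_inv, le_div_iff₀ hV2, inv_mul_le_iff₀ hV]
    exact (hX.volumeReal_ccBall_two_mul_le hx hr).trans_eq (mul_comm _ _)
  rw [h1, abs_mul, abs_inv, abs_of_pos hV, ← mul_assoc]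
  exact mul_le_mul h3 h2 (abs_nonneg _) (by positivity)

/-- Pointwise estimate of the oscillation by a telescoping sum over dyadic control balls. -/
theorem abs_sub_average_le (hX : XGeometry X Ω U Q CP ν) (hQ : 2 < Q)
    (hCP : 0 < CP) (hν : 0 < ν) {x : EucSp N} (hx : x ∈ Ω) {R : ℝ} (hR : 0 < R)
    {φ : EucSp N → ℝ} (hφ : ContDiff ℝ 1 φ) (hc : HasCompactSupport φ) {ω G s : ℝ} (hω : 0 < ω)
    (hV : ∀ i : ℕ, ω ≤ (2 ^ Q) ^ i * volume.real (ccBall X U x (ν * R / 2 ^ i)))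
    (hG : ∫ y, ‖xGrad X φ y‖ ^ 2 ≤ G) (hs : 0 ≤ s)
    (hgood : ∀ i : ℕ, ∫ y in ccBall X U x (ν * R / 2 ^ i), ‖xGrad X φ y‖ ^ 2
      ≤ s ^ 2 * volume.real (ccBall X U x (ν * R / 2 ^ i))) (k : ℕ) :
    |φ x - ⨍ y in ccBall X U x R, φ y| ≤ 2 ^ Q * CP * R *
      ((2 ^ (Q / 2 - 1) : ℝ) ^ k * √(G / ω) / ((2 : ℝ) ^ (Q / 2 - 1) - 1) + 2 * (s / 2 ^ k)) := by
  set τ : ℝ := 2 ^ (Q / 2 - 1) with hτ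
  have hτ1 : 1 < τ := Real.one_lt_rpow one_lt_two (by linarith)
  have hτ2 : τ ^ 2 = 2 ^ Q / 4 := by
    rw [hτ, ← Real.rpow_natCast, ← Real.rpow_mul zero_le_two,
      show (Q / 2 - 1) * ((2 : ℕ) : ℝ) = Q - 2 by push_cast; ring, Real.rpow_sub two_pos]
    norm_num
  set V : ℕ → ℝ := fun i => volume.real (ccBall X U x (ν * R / 2 ^ i)) with hVdef
  have hVpos : ∀ i, 0 < V i := fun i => hX.volumeReal_ccBall_pos hx (by positivity)
  set a : ℕ → ℝ := fun i => (V i)⁻¹ * ∫ y in ccBall X U x (ν * R / 2 ^ i), ‖xGrad X φ y‖ with ha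
  have hg1 : Integrable (fun y => ‖xGrad X φ y‖) := integrable_norm_xGrad hX.continuous hφ hc _
  have hg2 : Integrable (fun y => ‖xGrad X φ y‖ ^ 2) :=
    integrable_norm_xGrad_sq hX.continuous hφ hc _
  have ha0 : ∀ i, 0 ≤ a i := fun i =>
    mul_nonneg (inv_nonneg.2 (hVpos i).le) (integral_nonneg fun _ => norm_nonneg _)
  have hG0 : 0 ≤ G := (integral_nonneg fun _ => sq_nonneg _).trans hG
  have hasq : ∀ i, a i ^ 2 ≤ (V i)⁻¹ * ∫ y in ccBall X U x (ν * R / 2 ^ i), ‖xGrad X φ y‖ ^ 2 :=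
    fun i => by
      have := sq_setIntegral_le (hX.volume_ccBall_lt_top hx (ν * R / 2 ^ i)).ne
        hg1.integrableOn hg2.integrableOn
      have hVi := hVpos i
      rw [ha, mul_pow, inv_pow, inv_mul_le_iff₀ (by positivity)]
      refine this.trans_eq ?_
      change V i * _ = _
      field_simp
  have has : ∀ i, a i ≤ s := fun i => by
    refine le_of_sq_le_sq ((hasq i).trans ?_) hs
    rw [inv_mul_le_iff₀ (hVpos i), mul_comm (V i)]
    exact hgood i
  -- The square is at most `G / (4^i V i)`, and `V i ≥ ω / (2^Q)^i`; the ratio `2^Q / 4` is `τ²`.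
  have haG : ∀ i, a i / 2 ^ i ≤ τ ^ i * √(G / ω) := fun i => by
    refine le_of_sq_le_sq ?_ (by positivity)
    rw [mul_pow, Real.sq_sqrt (by positivity), div_pow, ← pow_mul τ, mul_comm i, pow_mul, hτ2,
      div_pow, ← pow_mul (2 : ℝ), mul_comm i, pow_mul (2 : ℝ), show (2 : ℝ) ^ 2 = 4 by norm_num,
      div_mul_eq_mul_div]
    gcongr
    refine (hasq i).trans ?_
    rw [inv_mul_le_iff₀ (hVpos i)]
    have h1 : ∫ y in ccBall X U x (ν * R / 2 ^ i), ‖xGrad X φ y‖ ^ 2 ≤ G :=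
      (setIntegral_le_integral hg2 (Eventually.of_forall fun _ => sq_nonneg _)).trans hG
    refine h1.trans ?_
    calc G = ω * (G / ω) := by field_simp
      _ ≤ ((2 ^ Q) ^ i * V i) * (G / ω) := by gcongr; exact hV i
      _ = _ := by ring
  set u : ℕ → ℝ := fun i => ⨍ y in ccBall X U x (R / 2 ^ i), φ y with hu
  have hstep : ∀ i, |u (i + 1) - u i| ≤ 2 ^ Q * CP * R * (a i / 2 ^ i) := fun i => by
    have h1 := hX.abs_average_succ_sub_le hx (r := R / 2 ^ (i + 1)) (by positivity) hφ hc
    have e : 2 * (R / 2 ^ (i + 1)) = R / 2 ^ i := by rw [pow_succ]; field_simp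
    rw [e, ← mul_div_assoc ν R] at h1
    refine h1.trans_eq ?_
    change 2 ^ Q * (CP * (R / 2 ^ i) * a i) = _
    ring
  have hsum : ∀ n, |u n - u 0| ≤ 2 ^ Q * CP * R * ∑ i ∈ Finset.range n, a i / 2 ^ i := by
    intro n
    induction n with
    | zero => simp
    | succ n ih =>
      rw [Finset.sum_range_succ, mul_add]
      calc |u (n + 1) - u 0| = |(u n - u 0) + (u (n + 1) - u n)| := by congr 1; ring
        _ ≤ _ := (abs_add_le _ _).trans (add_le_add ih (hstep n))
  -- By continuity of `φ` the telescoping reaches the value at every point `x`, with no exceptional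
  -- null set.
  have hlim : Tendsto (fun n => |u n - u 0|) atTop (𝓝 |φ x - u 0|) :=
    ((hX.tendsto_average_ccBall hx hR hφ.continuous
      (hφ.continuous.integrable_of_hasCompactSupport hc)).sub_const _).abs
  have hu0 : u 0 = ⨍ y in ccBall X U x R, φ y := by simp [hu]
  rw [← hu0]
  refine le_of_tendsto' hlim fun n => (hsum n).trans ?_
  refine mul_le_mul_of_nonneg_left ?_ (by positivity)
  exact sum_range_le_of_le_min hτ1 hs (Real.sqrt_nonneg _)
    (fun i => div_le_div_of_nonneg_right (has i) (by positivity)) haG k n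

/-- The weak Sobolev inequality along a geometric sequence of levels. -/
theorem exists_volume_lt_abs_le (hX : XGeometry X Ω U Q CP ν) (hN : 0 < N) (hΩ : IsOpen Ω)
    (hΩb : Bornology.IsBounded Ω) (hU : IsOpen U) (hΩU : Ω ⊆ U) (hQ : 2 < Q) (hCP : 0 < CP)
    (hν : 0 < ν) (hne : Ω.Nonempty) :
    ∃ A B : ℝ, 0 < A ∧ 0 < B ∧ ∀ (G : ℝ), 0 < G → ∀ φ : EucSp N → ℝ, ContDiff ℝ 1 φ →
      HasCompactSupport φ → tsupport φ ⊆ Ω → ∫ y, ‖xGrad X φ y‖ ^ 2 ≤ G → ∀ k : ℕ,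
      volume {x | x ∈ Ω ∧ A * (2 ^ (Q / 2 - 1) : ℝ) ^ k * √G < |φ x|}
        ≤ ENNReal.ofReal (B / (2 ^ Q) ^ k) := by
  have hΩm := hΩ.measurableSet
  have hΩfin : volume Ω ≠ ⊤ := hΩb.measure_lt_top.ne
  set ω := volume.real Ω with hω
  have hω0 : 0 < ω := ENNReal.toReal_pos (hΩ.measure_pos volume hne).ne' hΩfin
  obtain ⟨R, hR, hRΩ⟩ := hX.exists_subset_ccBall hΩb hΩU hν
  obtain ⟨CF, hCF, hF⟩ := hX.exists_integral_abs_le hN hΩ hΩb hΩU hν hCP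
  set τ : ℝ := 2 ^ (Q / 2 - 1) with hτ
  have hτ1 : 1 < τ := Real.one_lt_rpow one_lt_two (by linarith)
  have hτ2 : τ ^ 2 = 2 ^ Q / 4 := by
    rw [hτ, ← Real.rpow_natCast, ← Real.rpow_mul zero_le_two,
      show (Q / 2 - 1) * ((2 : ℕ) : ℝ) = Q - 2 by push_cast; ring, Real.rpow_sub two_pos]
    norm_num
  have hτ10 : 0 < τ - 1 := by linarith
  set A₁ := CF * √ω / ω with hA₁
  set A₂ := 2 ^ Q * CP * R * (1 / (τ - 1) + 2) / √ω with hA₂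
  have hA₁0 : 0 ≤ A₁ := by positivity
  have hA₂0 : 0 < A₂ := by positivity
  refine ⟨A₁ + A₂, (2 ^ Q) ^ 3 * ω, by positivity, by positivity,
    fun G hG φ hφ hc hφΩ hφG k => ?_⟩
  have hg1 : Integrable (fun y => ‖xGrad X φ y‖) := integrable_norm_xGrad hX.continuous hφ hc _
  have hg2 : Integrable (fun y => ‖xGrad X φ y‖ ^ 2) :=
    integrable_norm_xGrad_sq hX.continuous hφ hc _
  -- Chosen so that `s / 2^k = τ^k √(G/ω)`: at index `k` the energy bound and the maximal function
  -- bound agree.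
  set s := 2 ^ k * τ ^ k * √(G / ω) with hs
  have hs0 : 0 < s := by positivity
  have hssq : s ^ 2 = (2 ^ Q) ^ k * (G / ω) := by
    rw [hs, mul_pow, Real.sq_sqrt (by positivity), mul_pow, ← pow_mul τ, mul_comm k, pow_mul τ, hτ2,
      ← pow_mul (2 : ℝ), mul_comm k, pow_mul (2 : ℝ), ← mul_pow]
    congr 2
    ring
  -- the bound at points where all the averages of the squared gradient are at most `s ^ 2`
  have hgood : ∀ x ∈ Ω, (∀ i : ℕ, ∫ y in ccBall X U x (ν * R / 2 ^ i), ‖xGrad X φ y‖ ^ 2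
      ≤ s ^ 2 * volume.real (ccBall X U x (ν * R / 2 ^ i))) →
      |φ x| ≤ (A₁ + A₂) * τ ^ k * √G := by
    intro x hx h
    have h1 := hX.abs_sub_average_le hQ hCP hν hx hR hφ hc hω0
      (fun i => hX.volumeReal_le_of_subset_ccBall hx (mul_pos hν hR) (hRΩ x hx).2 i) hφG hs0.le h k
    have h2 : 2 ^ Q * CP * R * (τ ^ k * √(G / ω) / (τ - 1) + 2 * (s / 2 ^ k)) = A₂ * τ ^ k * √G := by
      rw [hA₂, hs, Real.sqrt_div hG.le]
      field_simp
    rw [h2] at h1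
    -- The average at the top scale is where the Friedrichs inequality enters, followed by
    -- Cauchy–Schwarz on `Ω`.
    have h3 : |⨍ y in ccBall X U x R, φ y| ≤ A₁ * √G := by
      have hV : ω ≤ volume.real (ccBall X U x R) :=
        measureReal_mono (hRΩ x hx).1 (hX.volume_ccBall_lt_top hx R).ne
      rw [setAverage_eq, smul_eq_mul, abs_mul, abs_inv, abs_of_pos (hω0.trans_le hV)]
      have h4 : |∫ y in ccBall X U x R, φ y| ≤ ∫ y in Ω, |φ y| := by
        refine abs_integral_le_integral_abs.trans ?_
        rw [setIntegral_eq_integral_of_forall_compl_eq_zero (s := Ω) fun y hy => by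
          rw [image_eq_zero_of_notMem_tsupport fun h => hy (hφΩ h), abs_zero]]
        exact setIntegral_le_integral (hφ.continuous.integrable_of_hasCompactSupport hc).abs
          (Eventually.of_forall fun _ => abs_nonneg _)
      have h5 : ∫ y in Ω, ‖xGrad X φ y‖ ≤ √ω * √G := by
        rw [← Real.sqrt_mul hω0.le]
        refine Real.le_sqrt_of_sq_le ((sq_setIntegral_le hΩfin hg1.integrableOn
          hg2.integrableOn).trans ?_)
        exact mul_le_mul_of_nonneg_left ((setIntegral_le_integral hg2
          (Eventually.of_forall fun _ => sq_nonneg _)).trans hφG) hω0.le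
      calc _ ≤ ω⁻¹ * (CF * (√ω * √G)) := by
            refine mul_le_mul (inv_anti₀ hω0 hV) (h4.trans ((hF φ hφ hc hφΩ).trans ?_))
              (abs_nonneg _) (by positivity)
            exact mul_le_mul_of_nonneg_left h5 hCF
        _ = A₁ * √G := by rw [hA₁]; field_simp
    have h6 : A₁ * √G ≤ A₁ * τ ^ k * √G := by
      gcongr
      exact le_mul_of_one_le_right hA₁0 (one_le_pow₀ hτ1.le)
    have h7 := abs_add_le (φ x - ⨍ y in ccBall X U x R, φ y) (⨍ y in ccBall X U x R, φ y)
    rw [sub_add_cancel] at h7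
    linarith
  set η : Measure (EucSp N) := volume.withDensity fun y => ENNReal.ofReal (‖xGrad X φ y‖ ^ 2) with hη
  have hηapp : ∀ S, MeasurableSet S → η S = ENNReal.ofReal (∫ y in S, ‖xGrad X φ y‖ ^ 2) :=
    fun S hS => by
      rw [hη, withDensity_apply _ hS, ofReal_integral_eq_lintegral_ofReal hg2.integrableOn
        (Eventually.of_forall fun _ => sq_nonneg _)]
  have hcov := hX.mul_volume_le_of_forall_exists hU hΩU (mul_pos hν hR) η (ENNReal.ofReal (s ^ 2))
  have hsub : {x | x ∈ Ω ∧ (A₁ + A₂) * τ ^ k * √G < |φ x|} ⊆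
      {x | x ∈ Ω ∧ ∃ i : ℕ, ENNReal.ofReal (s ^ 2) * volume (ccBall X U x (ν * R / 2 ^ i))
      ≤ η (ccBall X U x (ν * R / 2 ^ i))} := by
    rintro x ⟨hx, hlt⟩
    refine ⟨hx, ?_⟩
    by_contra! hcon
    refine absurd (hgood x hx fun i => ?_) (not_le.2 hlt)
    have h1 := (hcon i).le
    have hfin := (hX.volume_ccBall_lt_top hx (ν * R / 2 ^ i)).ne
    rw [hηapp _ (hX.isOpen_ccBall hU _ _).measurableSet, ← ofReal_measureReal hfin,
      ← ENNReal.ofReal_mul (by positivity)] at h1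
    exact (ENNReal.ofReal_le_ofReal_iff (by positivity)).1 h1
  have hs2 : 0 < s ^ 2 := by positivity
  have h1 := (mul_le_mul_right (measure_mono hsub) (ENNReal.ofReal (s ^ 2))).trans hcov
  rw [hηapp _ MeasurableSet.univ, setIntegral_univ, ← ENNReal.ofReal_pow (by positivity),
    ← ENNReal.ofReal_mul (by positivity), mul_comm,
    ← ENNReal.le_div_iff_mul_le (Or.inl (by simpa using hs0.ne')) (Or.inl ENNReal.ofReal_ne_top),
    ← ENNReal.ofReal_div_of_pos hs2] at h1
  refine h1.trans (ENNReal.ofReal_le_ofReal ?_)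
  rw [div_le_iff₀ hs2, hssq]
  calc (2 ^ Q) ^ 3 * ∫ y, ‖xGrad X φ y‖ ^ 2 ≤ (2 ^ Q) ^ 3 * G := by gcongr
    _ = _ := by field_simp

/-- The weak Sobolev inequality for test functions. -/
theorem exists_volume_le_abs_le (hX : XGeometry X Ω U Q CP ν) (hN : 0 < N) (hΩ : IsOpen Ω)
    (hΩb : Bornology.IsBounded Ω) (hU : IsOpen U) (hΩU : Ω ⊆ U) (hQ : 2 < Q) (hCP : 0 < CP)
    (hν : 0 < ν) :
    ∃ C : ℝ, 0 < C ∧ ∀ (G : ℝ), 0 < G → ∀ φ : EucSp N → ℝ, ContDiff ℝ 1 φ →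
      HasCompactSupport φ → tsupport φ ⊆ Ω → ∫ y, ‖xGrad X φ y‖ ^ 2 ≤ G → ∀ l : ℝ, 0 < l →
      volume {x | x ∈ Ω ∧ l ≤ |φ x|} ≤ ENNReal.ofReal (C * (G / l ^ 2) ^ (Q / (Q - 2))) := by
  rcases Ω.eq_empty_or_nonempty with rfl | hne
  · exact ⟨1, one_pos, fun G _ φ _ _ _ _ l _ => by simp⟩
  obtain ⟨A, B, hA, hB, hAB⟩ := hX.exists_volume_lt_abs_le hN hΩ hΩb hU hΩU hQ hCP hν hne
  set τ : ℝ := 2 ^ (Q / 2 - 1) with hτ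
  have hτ1 : 1 < τ := Real.one_lt_rpow one_lt_two (by linarith)
  have hτ0 : 0 < τ := by linarith
  set p := Q / (Q - 2) with hp
  have hp0 : 0 < p := div_pos (by linarith) (by linarith)
  -- Levels grow like `τ^k` while measures decay like `2^(-Qk)`; this identity converts the pair
  -- into the exponent `Q/(Q-2)`.
  have hτp : (τ ^ 2) ^ p = 2 ^ Q := by
    rw [hτ, ← Real.rpow_natCast, ← Real.rpow_mul zero_le_two, ← Real.rpow_mul zero_le_two]
    congr 1
    have : Q - 2 ≠ 0 := by linarith
    rw [hp]; push_cast; field_simp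
  have hΩfin : volume Ω ≠ ⊤ := hΩb.measure_lt_top.ne
  set ω := volume.real Ω with hω
  have hω0 : 0 ≤ ω := measureReal_nonneg
  -- The factor `2` turns `l ≤ |φ x|` into the strict inequality of the level estimate.
  set A' := 2 * A with hA'
  have hA'0 : 0 < A' := by positivity
  refine ⟨(ω + B) * (A' ^ 2 * τ ^ 2) ^ p, by positivity, fun G hG φ hφ hc hφΩ hφG l hl => ?_⟩
  have hsG : 0 < √G := Real.sqrt_pos.2 hG
  have hCeq : (ω + B) * (A' ^ 2 * τ ^ 2) ^ p * (G / l ^ 2) ^ p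
      = (ω + B) * ((A' * τ * √G / l) ^ 2) ^ p := by
    rw [mul_assoc, ← Real.mul_rpow (by positivity) (by positivity), div_pow, mul_pow, mul_pow,
      Real.sq_sqrt hG.le]
    congr 2
    ring
  rw [hCeq]
  -- Below the first level the bound `|Ω|` is enough; above it, `l` lies between two consecutive
  -- levels.
  by_cases hlt : l < A' * √G
  · calc volume {x | x ∈ Ω ∧ l ≤ |φ x|} ≤ volume Ω := measure_mono fun x hx => hx.1
      _ = ENNReal.ofReal ω := (ofReal_measureReal hΩfin).symm
      _ ≤ _ := by
        refine ENNReal.ofReal_le_ofReal ?_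
        have : 1 ≤ ((A' * τ * √G / l) ^ 2) ^ p := by
          refine Real.one_le_rpow (one_le_pow₀ ?_) hp0.le
          rw [le_div_iff₀ hl, one_mul]
          nlinarith [mul_pos hA'0 hsG]
        nlinarith
  · push Not at hlt
    obtain ⟨k, hk1, hk2⟩ := exists_nat_pow_near (x := l / (A' * √G))
      ((one_le_div (by positivity)).2 hlt) hτ1
    rw [le_div_iff₀ (by positivity)] at hk1
    rw [div_lt_iff₀ (by positivity)] at hk2
    have hsub : {x | x ∈ Ω ∧ l ≤ |φ x|} ⊆ {x | x ∈ Ω ∧ A * τ ^ k * √G < |φ x|} := fun x hx => by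
      refine ⟨hx.1, lt_of_lt_of_le ?_ (hk1.trans hx.2)⟩
      have : 0 < A * τ ^ k * √G := by positivity
      rw [hA']; linarith
    refine (measure_mono hsub).trans ((hAB G hG φ hφ hc hφΩ hφG k).trans
      (ENNReal.ofReal_le_ofReal ?_))
    · have h1 : 1 ≤ ((A' * τ * √G / l) ^ 2) ^ p * (2 ^ Q) ^ k := by
        rw [← hτp, ← Real.rpow_natCast (((τ ^ 2) ^ p)), ← Real.rpow_mul (by positivity),
          mul_comm p, Real.rpow_mul (by positivity), Real.rpow_natCast,
          ← Real.mul_rpow (by positivity) (by positivity), ← pow_mul, mul_comm 2 k, pow_mul,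
          ← mul_pow]
        refine Real.one_le_rpow (one_le_pow₀ ?_) hp0.le
        rw [div_mul_eq_mul_div, le_div_iff₀ hl, one_mul]
        refine hk2.le.trans_eq ?_
        rw [pow_succ]; ring
      rw [div_le_iff₀ (by positivity), mul_assoc]
      nlinarith

end XGeometry

end Sobolev

/-! ### Composition of functions in `W₀^{1,2}` with smooth truncations -/

theorem MeasureTheory.MemLp.eLpNorm_two_eq_ofReal_sqrt {α E : Type*} [MeasurableSpace α]
    [NormedAddCommGroup E] {μ : Measure α} {f : α → E} (hf : MemLp f 2 μ) :
    eLpNorm f 2 μ = ENNReal.ofReal (√(∫ x, ‖f x‖ ^ 2 ∂μ)) := by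
  rw [hf.eLpNorm_eq_integral_rpow_norm two_ne_zero ENNReal.ofNat_ne_top, Real.sqrt_eq_rpow]
  simp

section Chain

variable {N m : ℕ} {X : Fin m → EucSp N → EucSp N} {Ω : Set (EucSp N)}
  {u : EucSp N → ℝ} {g : EucSp N → EucSp m}

theorem xGrad_comp {S : ℝ → ℝ} {φ : EucSp N → ℝ} {x : EucSp N} (hS : Differentiable ℝ S)
    (hφ : Differentiable ℝ φ) : xGrad X (fun y => S (φ y)) x = deriv S (φ x) • xGrad X φ x := by
  ext j
  have h := (hS (φ x)).hasDerivAt.comp_hasFDerivAt x (hφ x).hasFDerivAt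
  simp only [xGrad_apply, PiLp.smul_apply, smul_eq_mul]
  rw [show fderiv ℝ (fun y => S (φ y)) x = deriv S (φ x) • fderiv ℝ φ x from h.fderiv]
  simp

theorem tendsto_eLpNorm_two_smul {c : ℕ → EucSp N → ℝ} {μ : Measure (EucSp N)} (hg : MemLp g 2 μ)
    (hcm : ∀ n, AEStronglyMeasurable (c n) μ) {B : ℝ} (hcB : ∀ n x, |c n x| ≤ B)
    (hc : ∀ᵐ x ∂μ, Tendsto (fun n => c n x) atTop (𝓝 0)) :
    Tendsto (fun n => eLpNorm (fun x => c n x • g x) 2 μ) atTop (𝓝 0) := by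
  have hB : ∀ n x, ‖c n x • g x‖ ≤ ‖B • g x‖ := fun n x => by
    rw [norm_smul, norm_smul]
    exact mul_le_mul_of_nonneg_right ((hcB n x).trans (le_abs_self B)) (norm_nonneg _)
  have hmem : ∀ n, MemLp (fun x => c n x • g x) 2 μ := fun n =>
    (hg.const_smul B).of_le ((hcm n).smul hg.1) (Eventually.of_forall (hB n))
  have hlim : Tendsto (fun n => ∫ x, ‖c n x • g x‖ ^ 2 ∂μ) atTop (𝓝 (∫ _, (0 : ℝ) ∂μ)) := by
    refine tendsto_integral_of_dominated_convergence (fun x => ‖B • g x‖ ^ 2)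
      (fun n => ((hmem n).1.norm.pow 2))
      ((memLp_two_iff_integrable_sq_norm (hg.const_smul B).1).1 (hg.const_smul B))
      (fun n => Eventually.of_forall fun x => ?_) ?_
    · rw [Real.norm_of_nonneg (sq_nonneg _)]
      exact pow_le_pow_left₀ (norm_nonneg _) (hB n x) 2
    · filter_upwards [hc] with x hx
      simpa using ((hx.smul_const (g x)).norm.pow 2)
  rw [integral_zero] at hlim
  have h2 := ENNReal.tendsto_ofReal hlim.sqrt
  rw [Real.sqrt_zero, ENNReal.ofReal_zero] at h2
  exact h2.congr fun n => (hmem n).eLpNorm_two_eq_ofReal_sqrt.symm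

/-- The chain rule in `W₀^{1,2}(Ω, X)`. -/
theorem HasXGradientW0.comp (hX : ∀ j, Continuous (X j)) (hu : HasXGradientW0 X Ω 2 u g)
    {S : ℝ → ℝ} (hS : ContDiff ℝ (⊤ : ℕ∞) S) (hS0 : S 0 = 0)
    (hSL : ∀ a b, |S a - S b| ≤ |a - b|) (hS' : ∀ s, |deriv S s| ≤ 1) :
    HasXGradientW0 X Ω 2 (fun x => S (u x)) (fun x => deriv S (u x) • g x) := by
  obtain ⟨hum, hgm, φ, hφ, hφu, hφg⟩ := hu
  have hSc : Continuous S := hS.continuous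
  have hS'c : Continuous (deriv S) := hS.continuous_deriv (by simp)
  have hSd : Differentiable ℝ S := hS.differentiable (by simp)
  have hφ1 : ∀ n, ContDiff ℝ 1 (φ n) := fun n => (hφ n).1.of_le (by exact_mod_cast le_top)
  have hφm : ∀ n, AEStronglyMeasurable (φ n) (volume.restrict Ω) := fun n =>
    (hφ1 n).continuous.aestronglyMeasurable
  -- Almost everywhere convergence along a subsequence is needed for `S'(φ n) → S'(u)`, which
  -- multiplies `g` and is treated by dominated convergence.
  obtain ⟨ns, hns, hae⟩ := (tendstoInMeasure_of_tendsto_eLpNorm one_ne_zero hφm hum.1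
    hφu).exists_seq_tendsto_ae
  refine ⟨hum.of_le (hSc.comp_aestronglyMeasurable hum.1) (Eventually.of_forall fun x => ?_),
    hgm.of_le ((hS'c.comp_aestronglyMeasurable hum.1).smul hgm.1)
      (Eventually.of_forall fun x => ?_), fun n x => S (φ (ns n) x), fun n => ⟨?_, ?_, ?_⟩, ?_, ?_⟩
  · simpa [hS0] using hSL (u x) 0
  · rw [norm_smul]
    exact mul_le_of_le_one_left (norm_nonneg _) (hS' _)
  · exact hS.comp (hφ _).1
  · exact (hφ (ns n)).2.1.comp_left hS0
  · refine (closure_mono ?_).trans (hφ (ns n)).2.2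
    exact Function.support_comp_subset hS0 _
  · refine tendsto_of_tendsto_of_tendsto_of_le_of_le tendsto_const_nhds (hφu.comp hns.tendsto_atTop)
      (fun _ => zero_le) fun n => ?_
    exact eLpNorm_mono fun x => hSL _ _
  · have h1 := hφg.comp hns.tendsto_atTop
    have h2 : Tendsto (fun n => eLpNorm (fun x => (deriv S (φ (ns n) x) - deriv S (u x)) • g x) 2
        (volume.restrict Ω)) atTop (𝓝 0) := by
      refine tendsto_eLpNorm_two_smul hgm (fun n => ?_) (B := 2) (fun n x => ?_) ?_
      · exact (hS'c.comp_aestronglyMeasurable (hφm _)).sub (hS'c.comp_aestronglyMeasurable hum.1)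
      · exact (abs_sub _ _).trans (by linarith [hS' (φ (ns n) x), hS' (u x)])
      · filter_upwards [hae] with x hx
        rw [← sub_self (deriv S (u x))]
        exact ((hS'c.tendsto _).comp hx).sub_const _
    have h3 := h1.add h2
    rw [add_zero] at h3
    refine tendsto_of_tendsto_of_tendsto_of_le_of_le tendsto_const_nhds h3
      (fun _ => zero_le) fun n => ?_
    have hXm : AEStronglyMeasurable (fun x => xGrad X (φ (ns n)) x - g x) (volume.restrict Ω) :=
      (continuous_xGrad hX (hφ1 _)).aestronglyMeasurable.sub hgm.1
    have hdm : AEStronglyMeasurable (fun x => deriv S (φ (ns n) x)) (volume.restrict Ω) :=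
      hS'c.comp_aestronglyMeasurable (hφm _)
    have hdu : AEStronglyMeasurable (fun x => deriv S (u x)) (volume.restrict Ω) :=
      hS'c.comp_aestronglyMeasurable hum.1
    calc eLpNorm (fun x => xGrad X (fun x => S (φ (ns n) x)) x - deriv S (u x) • g x) 2
          (volume.restrict Ω)
        = eLpNorm ((fun x => deriv S (φ (ns n) x) • (xGrad X (φ (ns n)) x - g x))
          + fun x => (deriv S (φ (ns n) x) - deriv S (u x)) • g x) 2 (volume.restrict Ω) := by
          congr 1
          ext1 x
          rw [xGrad_comp hSd ((hφ1 _).differentiable one_ne_zero), Pi.add_apply, smul_sub, sub_smul]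
          abel
      _ ≤ _ := eLpNorm_add_le (hdm.smul hXm) ((hdm.sub hdu).smul hgm.1) one_le_two
      _ ≤ _ := by
          gcongr
          refine eLpNorm_mono fun x => ?_
          rw [norm_smul]
          exact mul_le_of_le_one_left (norm_nonneg _) (hS' _)

/-! ### The weak Sobolev inequality in `W₀^{1,2}` -/

/-- The set `{|v| ≥ l}` lies in `{|φ n| ≥ l/2} ∪ {|φ n - v| ≥ l/2}`, and the second set disappears
in the limit; halving `l` costs `4^(Q/(Q-2))`. The strict bound on the energy leaves room for the
approximations. -/
theorem XGeometry.exists_volume_le_abs_le_of_hasXGradientW0 {U : Set (EucSp N)} {Q CP ν : ℝ}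
    (hX : XGeometry X Ω U Q CP ν) (hN : 0 < N) (hΩ : IsOpen Ω)
    (hΩb : Bornology.IsBounded Ω) (hU : IsOpen U) (hΩU : Ω ⊆ U) (hQ : 2 < Q) (hCP : 0 < CP)
    (hν : 0 < ν) :
    ∃ C : ℝ, 0 < C ∧ ∀ (G : ℝ) (v : EucSp N → ℝ) (h : EucSp N → EucSp m),
      HasXGradientW0 X Ω 2 v h → ∫ x in Ω, ‖h x‖ ^ 2 < G → ∀ l : ℝ, 0 < l →
      volume.restrict Ω {x | l ≤ |v x|} ≤ ENNReal.ofReal (C * (G / l ^ 2) ^ (Q / (Q - 2))) := by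
  obtain ⟨C, hC, hCb⟩ := hX.exists_volume_le_abs_le hN hΩ hΩb hU hΩU hQ hCP hν
  have hp0 : 0 < Q / (Q - 2) := div_pos (by linarith) (by linarith)
  refine ⟨C * 4 ^ (Q / (Q - 2)), by positivity, fun G v h hv hG l hl => ?_⟩
  obtain ⟨hvm, hhm, φ, hφ, hφu, hφg⟩ := hv
  have hG0 : 0 < G := lt_of_le_of_lt (integral_nonneg fun _ => sq_nonneg _) hG
  have hφ1 : ∀ n, ContDiff ℝ 1 (φ n) := fun n => (hφ n).1.of_le (by exact_mod_cast le_top)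
  have hmeas := tendstoInMeasure_of_tendsto_eLpNorm one_ne_zero
    (fun n => (hφ1 n).continuous.aestronglyMeasurable) hvm.1 hφu
  rw [tendstoInMeasure_iff_norm] at hmeas
  have hlim := (hmeas (l / 2) (by linarith)).const_add
    (ENNReal.ofReal (C * (G / (l / 2) ^ 2) ^ (Q / (Q - 2))))
  rw [add_zero] at hlim
  have hCeq : C * 4 ^ (Q / (Q - 2)) * (G / l ^ 2) ^ (Q / (Q - 2))
      = C * (G / (l / 2) ^ 2) ^ (Q / (Q - 2)) := by
    rw [mul_assoc, ← Real.mul_rpow (by norm_num) (by positivity)]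
    congr 2
    field_simp
    ring
  rw [hCeq]
  have hlt : eLpNorm h 2 (volume.restrict Ω) < ENNReal.ofReal (√G) := by
    rw [hhm.eLpNorm_two_eq_ofReal_sqrt]
    exact (ENNReal.ofReal_lt_ofReal_iff (Real.sqrt_pos.2 hG0)).2
      (Real.sqrt_lt_sqrt (integral_nonneg fun _ => sq_nonneg _) hG)
  have hsum := hφg.add_const (eLpNorm h 2 (volume.restrict Ω))
  rw [zero_add] at hsum
  refine ge_of_tendsto hlim ?_
  filter_upwards [hsum.eventually_lt_const hlt] with n hn
  have hXm : AEStronglyMeasurable (xGrad X (φ n)) (volume.restrict Ω) :=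
    (continuous_xGrad hX.continuous (hφ1 n)).aestronglyMeasurable
  have hXi := integrable_norm_xGrad_sq hX.continuous (hφ1 n) (hφ n).2.1 (volume.restrict Ω)
  have hle : ∫ y, ‖xGrad X (φ n) y‖ ^ 2 ≤ G := by
    have h1 : eLpNorm (xGrad X (φ n)) 2 (volume.restrict Ω) ≤ ENNReal.ofReal (√G) := by
      refine le_trans ?_ hn.le
      have := eLpNorm_add_le (hXm.sub hhm.1) hhm.1 (p := 2) one_le_two
      rwa [sub_add_cancel] at this
    rw [((memLp_two_iff_integrable_sq_norm hXm).2 hXi).eLpNorm_two_eq_ofReal_sqrt,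
      ENNReal.ofReal_le_ofReal_iff (Real.sqrt_nonneg _), Real.sqrt_le_sqrt_iff hG0.le,
      setIntegral_eq_integral_of_forall_compl_eq_zero fun y hy => by
        rw [xGrad_eq_zero_of_notMem_tsupport fun h => hy ((hφ n).2.2 h)]; simp] at h1
    exact h1
  have h2 := hCb G hG0 (φ n) (hφ1 n) (hφ n).2.1 (hφ n).2.2 hle (l / 2) (by linarith)
  have hsub : {x | l ≤ |v x|} ⊆ {x | l / 2 ≤ |φ n x|} ∪ {x | l / 2 ≤ ‖φ n x - v x‖} := fun x hx => by
    by_contra hcon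
    simp only [Set.mem_union, Set.mem_ofPred_eq, not_or, not_le, Real.norm_eq_abs] at hcon hx
    have := abs_sub_abs_le_abs_sub (v x) (φ n x)
    rw [abs_sub_comm] at this
    linarith [hcon.1, hcon.2]
  refine (measure_mono hsub).trans ((measure_union_le _ _).trans (add_le_add ?_ le_rfl))
  refine le_trans (le_of_eq ?_) h2
  rw [Measure.restrict_apply' hΩ.measurableSet]
  congr 1
  ext x
  exact and_comm

end Chain

/-! ### A smooth truncation -/

/-- A smooth odd function with values in `(-2 k, 2 k)` that is comparable to the identity on
`[-k, k]`. -/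
noncomputable def softTrunc (k s : ℝ) : ℝ := k * Real.arctan (s / k)

section SoftTrunc

variable {k : ℝ}

theorem contDiff_softTrunc {n : WithTop ℕ∞} : ContDiff ℝ n (softTrunc k) :=
  contDiff_const.mul (Real.contDiff_arctan.comp (contDiff_id.div_const k))

theorem softTrunc_zero : softTrunc k 0 = 0 := by simp [softTrunc]

theorem hasDerivAt_softTrunc (hk : 0 < k) (s : ℝ) :
    HasDerivAt (softTrunc k) (1 / (1 + (s / k) ^ 2)) s := by
  have h := ((Real.hasDerivAt_arctan (s / k)).comp s ((hasDerivAt_id s).div_const k)).const_mul k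
  exact h.congr_deriv (by field_simp)

theorem deriv_softTrunc (hk : 0 < k) (s : ℝ) : deriv (softTrunc k) s = 1 / (1 + (s / k) ^ 2) :=
  (hasDerivAt_softTrunc hk s).deriv

theorem deriv_softTrunc_pos (hk : 0 < k) (s : ℝ) : 0 < deriv (softTrunc k) s := by
  rw [deriv_softTrunc hk]; positivity

theorem deriv_softTrunc_le_one (hk : 0 < k) (s : ℝ) : deriv (softTrunc k) s ≤ 1 := by
  rw [deriv_softTrunc hk, div_le_one (by positivity)]
  linarith [sq_nonneg (s / k)]

theorem half_le_deriv_softTrunc (hk : 0 < k) {s : ℝ} (hs : |s| ≤ k) :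
    1 / 2 ≤ deriv (softTrunc k) s := by
  rw [deriv_softTrunc hk]
  have : (s / k) ^ 2 ≤ 1 := by
    rw [sq_le_one_iff_abs_le_one, abs_div, abs_of_pos hk]
    exact (div_le_one hk).2 hs
  gcongr
  linarith

theorem abs_softTrunc_sub_le (hk : 0 < k) (a b : ℝ) :
    |softTrunc k a - softTrunc k b| ≤ |a - b| := by
  have := Convex.norm_image_sub_le_of_norm_deriv_le (f := softTrunc k) (s := Set.univ) (C := 1)
    (x := b) (y := a) (fun x _ => (hasDerivAt_softTrunc hk x).differentiableAt)
    (fun x _ => by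
      rw [Real.norm_of_nonneg (deriv_softTrunc_pos hk x).le]
      exact deriv_softTrunc_le_one hk x) convex_univ (Set.mem_univ _) (Set.mem_univ _)
  simpa using this

theorem abs_softTrunc_le (hk : 0 < k) (s : ℝ) : |softTrunc k s| ≤ 2 * k := by
  have h1 := Real.arctan_lt_pi_div_two (s / k)
  have h2 := Real.neg_pi_div_two_lt_arctan (s / k)
  have h3 := Real.pi_lt_four
  rw [softTrunc, abs_mul, abs_of_pos hk, mul_comm]
  gcongr
  exact abs_le.2 ⟨by linarith, by linarith⟩

theorem half_le_abs_softTrunc (hk : 0 < k) {s : ℝ} (hs : k ≤ |s|) : k / 2 ≤ |softTrunc k s| := by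
  have h3 := Real.pi_gt_three
  have h4 : ∀ r : ℝ, 1 ≤ r → 1 / 2 ≤ Real.arctan r := fun r hr => by
    have := Real.arctan_strictMono.monotone hr
    rw [Real.arctan_one] at this
    linarith
  have h5 : 1 / 2 ≤ |Real.arctan (s / k)| := by
    rcases le_abs.1 hs with h | h
    · exact (h4 _ ((one_le_div hk).2 h)).trans (le_abs_self _)
    · rw [← abs_neg, ← Real.arctan_neg, ← neg_div]
      exact (h4 _ ((one_le_div hk).2 h)).trans (le_abs_self _)
  rw [softTrunc, abs_mul, abs_of_pos hk]
  nlinarith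

end SoftTrunc

/-! ### Weak solutions and Marcinkiewicz estimates -/

section Solutions

variable {N m : ℕ} {X : Fin m → EucSp N → EucSp N} {Ω U : Set (EucSp N)} {Q CP ν α β : ℝ}
  {A : EucSp N → Matrix (Fin m) (Fin m) ℝ} {f u : EucSp N → ℝ} {g : EucSp N → EucSp m}

theorem abs_truncAt_le {n : ℝ} (hn : 0 ≤ n) (s : ℝ) : |truncAt n s| ≤ |s| := by
  unfold truncAt
  split_ifs with h1 h2
  · rw [abs_of_nonneg hn, abs_of_pos (hn.trans_lt h1)]; exact h1.le
  · rw [abs_neg, abs_of_nonneg hn, abs_of_neg (by linarith)]; linarith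
  · exact le_rfl

/-- The energy estimate on the levels of a weak solution. -/
theorem IsWeakSolution.integral_deriv_softTrunc_mul_le (hX : ∀ j, Continuous (X j)) (hα : 0 < α)
    (hA : IsEllipticOn A Ω α β) {F : EucSp N → ℝ} (hF : IntegrableOn F Ω)
    (hfF : ∀ x, |f x| ≤ |F x|) (hu : IsWeakSolution X Ω A f u g) {M : ℝ}
    (hM : ∫ x in Ω, |F x| ≤ M) {k : ℝ} (hk : 0 < k) :
    HasXGradientW0 X Ω 2 (fun x => softTrunc k (u x)) (fun x => deriv (softTrunc k) (u x) • g x) ∧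
    IntegrableOn (fun x => deriv (softTrunc k) (u x) * ‖g x‖ ^ 2) Ω ∧
    ∫ x in Ω, deriv (softTrunc k) (u x) * ‖g x‖ ^ 2 ≤ 2 * k * M / α := by
  have hv := hu.1.comp hX (S := softTrunc k) contDiff_softTrunc softTrunc_zero
    (abs_softTrunc_sub_le hk) fun s => by
      rw [abs_of_pos (deriv_softTrunc_pos hk s)]; exact deriv_softTrunc_le_one hk s
  obtain ⟨hi1, hi2, heq⟩ := hu.2 _ _ hv
  have hd : Continuous (deriv (softTrunc k)) := by
    exact (contDiff_softTrunc (k := k) (n := 1)).continuous_deriv le_rfl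
  have hgm := hu.1.2.1
  have hint : IntegrableOn (fun x => deriv (softTrunc k) (u x) * ‖g x‖ ^ 2) Ω :=
    ((memLp_two_iff_integrable_sq_norm hgm.1).1 hgm).bdd_mul (c := 1)
      (hd.comp_aestronglyMeasurable hu.1.1.1) (Eventually.of_forall fun x => by
        rw [Real.norm_of_nonneg (deriv_softTrunc_pos hk _).le]; exact deriv_softTrunc_le_one hk _)
  refine ⟨hv, hint, ?_⟩
  rw [le_div_iff₀ hα, mul_comm, ← integral_const_mul]
  calc ∫ x in Ω, α * (deriv (softTrunc k) (u x) * ‖g x‖ ^ 2)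
      ≤ ∫ x in Ω, (A x *ᵥ (g x).ofLp) ⬝ᵥ (deriv (softTrunc k) (u x) • g x).ofLp := by
        refine integral_mono_ae (hint.const_mul α) hi1 ?_
        -- The test function has gradient `S'(u) g` with `S' > 0`, so the lower ellipticity bound
        -- can be multiplied by `S'(u)`.
        filter_upwards [hA.bounds] with x hx
        rw [WithLp.ofLp_smul, dotProduct_smul, smul_eq_mul]
        have h1 := (hx (g x)).1
        have h2 := deriv_softTrunc_pos hk (u x)
        nlinarith
    _ = ∫ x in Ω, f x * softTrunc k (u x) := heq
    _ ≤ ∫ x in Ω, 2 * k * |F x| := by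
        refine integral_mono hi2 (hF.abs.const_mul _) fun x => ?_
        calc f x * softTrunc k (u x) ≤ |f x| * |softTrunc k (u x)| := by
              rw [← abs_mul]; exact le_abs_self _
          _ ≤ |F x| * (2 * k) := mul_le_mul (hfF x) (abs_softTrunc_le hk _) (abs_nonneg _)
              (abs_nonneg _)
          _ = _ := mul_comm _ _
    _ ≤ 2 * k * M := by
        rw [integral_const_mul]
        gcongr

/-- The level set bounds are available only for `M > E`, which keeps `M` positive even if `f = 0`;
the norm bound follows by letting `M` decrease to `E`. -/
theorem memMarcinkiewicz_and_norm_le {F : Type*} [NormedAddCommGroup F] {w : EucSp N → F} {p : ℝ}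
    (hp : 0 < p) (hw : AEStronglyMeasurable w (volume.restrict Ω)) {D E : ℝ} (hD : 0 ≤ D)
    (hE : 0 ≤ E)
    (h : ∀ M : ℝ, E < M → ∀ t : ℝ, 0 < t →
      volume.restrict Ω {x | t ≤ ‖w x‖} ≤ ENNReal.ofReal (D * (M / t) ^ p)) :
    MemMarcinkiewicz Ω p w ∧
      marcinkiewiczNorm Ω p w ≤ ENNReal.ofReal (D ^ (1 / p)) * ENNReal.ofReal E := by
  have hK : ∀ M : ℝ, E < M → ENNReal.ofReal (D * M ^ p) ∈ marcinkiewiczConstants Ω p w := by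
    intro M hM t ht
    refine (h M hM t ht).trans_eq ?_
    rw [← ENNReal.ofReal_div_of_pos (by positivity), Real.div_rpow (hE.trans hM.le) ht.le,
      mul_div_assoc]
  refine ⟨⟨hw, _, hK (E + 1) (by linarith), ENNReal.ofReal_lt_top⟩, ?_⟩
  have hle : ∀ M : ℝ, E < M → marcinkiewiczNorm Ω p w ≤ ENNReal.ofReal (D ^ (1 / p) * M) := by
    intro M hM
    have hM0 : 0 ≤ M := hE.trans hM.le
    refine (ENNReal.rpow_le_rpow (sInf_le (hK M hM)) (by positivity)).trans_eq ?_
    rw [ENNReal.ofReal_rpow_of_nonneg (by positivity) (by positivity),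
      Real.mul_rpow hD (by positivity), ← Real.rpow_mul hM0, mul_one_div_cancel hp.ne',
      Real.rpow_one]
  rw [← ENNReal.ofReal_mul (by positivity)]
  have hcont : Tendsto (fun M : ℝ => ENNReal.ofReal (D ^ (1 / p) * M)) (𝓝[>] E)
      (𝓝 (ENNReal.ofReal (D ^ (1 / p) * E))) :=
    (ENNReal.continuous_ofReal.comp (continuous_const.mul continuous_id)).continuousWithinAt.tendsto
  exact ge_of_tendsto hcont (eventually_mem_nhdsWithin.mono fun M hM => hle M hM)

/-- Level set estimates for weak solutions and their `X`-gradients. -/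
theorem XGeometry.exists_volume_level_le (hX : XGeometry X Ω U Q CP ν) (hN : 0 < N) (hΩ : IsOpen Ω)
    (hΩb : Bornology.IsBounded Ω) (hU : IsOpen U) (hΩU : Ω ⊆ U) (hQ : 2 < Q) (hCP : 0 < CP)
    (hν : 0 < ν) (hα : 0 < α) :
    ∃ C : ℝ, 0 < C ∧ ∀ (β : ℝ) (A : EucSp N → Matrix (Fin m) (Fin m) ℝ) (F f u : EucSp N → ℝ)
      (g : EucSp N → EucSp m), IsEllipticOn A Ω α β → IntegrableOn F Ω → (∀ x, |f x| ≤ |F x|) →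
      IsWeakSolution X Ω A f u g → ∀ M : ℝ, ∫ x in Ω, |F x| < M → ∀ t : ℝ, 0 < t →
      volume.restrict Ω {x | t ≤ ‖u x‖} ≤ ENNReal.ofReal (C * (M / t) ^ (Q / (Q - 2))) ∧
      volume.restrict Ω {x | t ≤ ‖g x‖} ≤ ENNReal.ofReal (C * (M / t) ^ (Q / (Q - 1))) := by
  obtain ⟨C, hC, hCb⟩ := hX.exists_volume_le_abs_le_of_hasXGradientW0 hN hΩ hΩb hU hΩU hQ hCP hν
  set p := Q / (Q - 2) with hp
  set q := Q / (Q - 1) with hq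
  have hp0 : 0 < p := div_pos (by linarith) (by linarith)
  set C₁ := C * (12 / α) ^ p with hC₁
  have hC₁0 : 0 < C₁ := by positivity
  refine ⟨C₁ + 4 / α, by positivity, fun β A F f u g hA hF hfF hu M hM t ht => ?_⟩
  have hM0 : 0 < M := lt_of_le_of_lt (integral_nonneg fun _ => abs_nonneg _) hM
  have hlevel : ∀ k : ℝ, 0 < k →
      volume.restrict Ω {x | k ≤ ‖u x‖} ≤ ENNReal.ofReal (C₁ * (M / k) ^ p) := by
    intro k hk
    obtain ⟨hv, hint, hE⟩ := hu.integral_deriv_softTrunc_mul_le hX.continuous hα hA hF hfF hM.le hk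
    -- As `0 < S' ≤ 1`, one has `S'² ≤ S'`; the constant `3` in place of `2` makes the inequality
    -- strict.
    have hG : ∫ x in Ω, ‖deriv (softTrunc k) (u x) • g x‖ ^ 2 < 3 * k * M / α := by
      refine lt_of_le_of_lt (b := 2 * k * M / α) (le_trans ?_ hE) (by gcongr; norm_num)
      refine integral_mono_of_nonneg (Eventually.of_forall fun _ => sq_nonneg _) hint
        (Eventually.of_forall fun x => ?_)
      have h1 := deriv_softTrunc_pos hk (u x)
      have h2 := deriv_softTrunc_le_one hk (u x)
      simp only [norm_smul, Real.norm_of_nonneg h1.le, mul_pow]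
      gcongr
      nlinarith
    have h1 := hCb _ _ _ hv hG (k / 2) (by linarith)
    refine (measure_mono fun x hx => half_le_abs_softTrunc hk hx).trans (h1.trans_eq ?_)
    congr 1
    rw [hC₁, mul_assoc C, ← Real.mul_rpow (by positivity) (by positivity)]
    congr 2
    field_simp
    norm_num
  constructor
  · refine (hlevel t ht).trans (ENNReal.ofReal_le_ofReal ?_)
    gcongr
    exact le_add_of_nonneg_right (by positivity)
  · set y := M / t with hy
    have hy0 : 0 < y := by positivity
    set e := (Q - 2) / (Q - 1) with he
    have hQ1 : Q - 1 ≠ 0 := by linarith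
    have hQ2 : Q - 2 ≠ 0 := by linarith
    -- The level at which `(M/k)^p`, from `{|u| ≥ k}`, and `k M / t²`, from Chebyshev, are both
    -- equal to `(M/t)^q`.
    set k := M / y ^ e with hk
    have hk0 : 0 < k := by positivity
    obtain ⟨hv, hint, hE⟩ := hu.integral_deriv_softTrunc_mul_le hX.continuous hα hA hF hfF hM.le hk0
    have hMk : (M / k) ^ p = y ^ q := by
      rw [hk, div_div_cancel₀ hM0.ne', ← Real.rpow_mul hy0.le]
      congr 1
      rw [he, hp, hq]
      field_simp
    have hkM : k * M / t ^ 2 = y ^ q := by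
      have h1 : q = 2 - e := by rw [hq, he]; field_simp; ring
      rw [h1, Real.rpow_sub hy0, hk, hy]
      simp only [Real.rpow_two]
      field_simp
    have h1 := hlevel k hk0
    rw [hMk] at h1
    have hμ : IsFiniteMeasure (volume.restrict Ω) :=
      isFiniteMeasure_restrict.2 hΩb.measure_lt_top.ne
    have h2 : volume.restrict Ω {x | t ^ 2 / 2 ≤ deriv (softTrunc k) (u x) * ‖g x‖ ^ 2}
        ≤ ENNReal.ofReal (4 / α * y ^ q) := by
      have h3 := mul_meas_ge_le_integral_of_nonneg (Eventually.of_forall fun x =>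
        mul_nonneg (deriv_softTrunc_pos hk0 (u x)).le (sq_nonneg ‖g x‖)) hint (t ^ 2 / 2)
      rw [← ofReal_measureReal (measure_ne_top _ _)]
      refine ENNReal.ofReal_le_ofReal ?_
      rw [← hkM]
      have h4 := h3.trans hE
      rw [← le_div_iff₀' (by positivity)] at h4
      refine h4.trans_eq ?_
      field_simp
      norm_num
    -- Where `|u| < k` the weight `S'(u)` is at least `1/2`, which explains the threshold `t²/2`.
    have hsub : {x | t ≤ ‖g x‖} ⊆ {x | k ≤ ‖u x‖} ∪
        {x | t ^ 2 / 2 ≤ deriv (softTrunc k) (u x) * ‖g x‖ ^ 2} := fun x (hx : t ≤ ‖g x‖) => by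
      by_cases h : k ≤ ‖u x‖
      · exact Or.inl h
      · right
        have h5 := half_le_deriv_softTrunc hk0 (not_le.1 h).le
        have h6 : t ^ 2 ≤ ‖g x‖ ^ 2 := pow_le_pow_left₀ ht.le hx 2
        show t ^ 2 / 2 ≤ deriv (softTrunc k) (u x) * ‖g x‖ ^ 2
        nlinarith [sq_nonneg ‖g x‖]
    refine (measure_mono hsub).trans ((measure_union_le _ _).trans ((add_le_add h1 h2).trans_eq ?_))
    rw [← ENNReal.ofReal_add (by positivity) (by positivity), add_mul]

end Solutions

theorem theorem3p1 {N m : ℕ} (hN : 2 ≤ N) (X : Fin m → EucSp N → EucSp N)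
    (Ω U : Set (EucSp N)) (hΩ : IsOpen Ω) (hΩb : Bornology.IsBounded Ω)
    (hU : IsOpen U) (hΩU : Ω ⊆ U)
    (Q CP ν : ℝ) (hQ : 2 < Q) (hCP : 0 < CP) (hν : 0 < ν) (hX : XGeometry X Ω U Q CP ν)
    (α : ℝ) (hα : 0 < α) :
    ∃ C : ℝ≥0,
      ∀ (β : ℝ) (A : EucSp N → Matrix (Fin m) (Fin m) ℝ) (f : EucSp N → ℝ)
        (u : ℕ → EucSp N → ℝ) (Xu : ℕ → EucSp N → EucSp m),
        α < β → IsEllipticOn A Ω α β → IntegrableOn f Ω →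
        (∀ n : ℕ, IsWeakSolution X Ω A (fun x => truncAt n (f x)) (u n) (Xu n)) →
        ∀ n : ℕ,
          (MemMarcinkiewicz Ω (Q / (Q - 2)) (u n) ∧
            marcinkiewiczNorm Ω (Q / (Q - 2)) (u n) ≤ C * eLpNorm f 1 (volume.restrict Ω)) ∧
          (MemMarcinkiewicz Ω (Q / (Q - 1)) (Xu n) ∧
            marcinkiewiczNorm Ω (Q / (Q - 1)) (Xu n) ≤ C * eLpNorm f 1 (volume.restrict Ω)) := by
  obtain ⟨D, hD, hDb⟩ := hX.exists_volume_level_le (by lia) hΩ hΩb hU hΩU hQ hCP hν hα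
  have hp : 0 < Q / (Q - 2) := div_pos (by linarith) (by linarith)
  have hq : 0 < Q / (Q - 1) := div_pos (by linarith) (by linarith)
  refine ⟨(D ^ (1 / (Q / (Q - 2)))).toNNReal + (D ^ (1 / (Q / (Q - 1)))).toNNReal,
    fun β A f u Xu _ hA hf hu n => ?_⟩
  have hnorm : eLpNorm f 1 (volume.restrict Ω) = ENNReal.ofReal (∫ x in Ω, |f x|) := by
    rw [eLpNorm_one_eq_lintegral_enorm, ← ofReal_integral_norm_eq_lintegral_enorm hf]
    rfl
  -- Of the truncated data only `|T_n f| ≤ |f|` is used, hence the uniformity in `n`.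
  have h := hDb β A f _ (u n) (Xu n) hA hf (fun x => abs_truncAt_le n.cast_nonneg (f x)) (hu n)
  have hE : 0 ≤ ∫ x in Ω, |f x| := integral_nonneg fun _ => abs_nonneg _
  have h1 := memMarcinkiewicz_and_norm_le hp (hu n).1.1.1 hD.le hE fun M hM t ht => (h M hM t ht).1
  have h2 := memMarcinkiewicz_and_norm_le hq (hu n).1.2.1.1 hD.le hE fun M hM t ht => (h M hM t ht).2
  rw [hnorm, ENNReal.coe_add]
  refine ⟨⟨h1.1, h1.2.trans ?_⟩, ⟨h2.1, h2.2.trans ?_⟩⟩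
  · exact mul_le_mul_left le_self_add _
  · exact mul_le_mul_left le_add_self _
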